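/- Let $\Bbbk$ be an algebraically closed field of characteristic zero, and let $H$ be a Hopf algebra over $\Bbbk$, finitely generated as a $\Bbbk$-algebra, with a central Hopf subalgebra $C$ such that $H$ is a finitely generated $C$-module. For a maximal ideal $\mathfrak m$ of $C$ let $H/\mathfrak mH$ be the fiber algebra at $\mathfrak m$, a finite-dimensional $\Bbbk$-algebra, let $\mathrm{Irr}(H/\mathfrak mH)$ be the (finite) set of isomorphism classes of its irreducible left modules, and put $$\mathrm{Sd}(\mathfrak m)=\sum_{[V]\in \mathrm{Irr}(H/\mathfrak mH)}(\dim_\Bbbk V)^2 .$$ Let $\mathfrak m_{\overline\varepsilon}$ be the kernel of the counit of $C$, so that $H/\mathfrak m_{\overline\varepsilon}H$ is a finite-dimensional Hopf algebra. Tensor products of $H$-modules are taken over $\Bbbk$, with $H$ acting through the coproduct, and $W^*$ is the dual space of $W$ with $(h\xi)(w)=\xi(S(h)w)$, where $S$ is the antipode of $H$. If $W$ is an $H/\mathfrak mH$-module, then $W\otimes W^*$ is an $H/\mathfrak m_{\overline\varepsilon}H$-module. Assume that $H/\mathfrak m_{\overline\varepsilon}H$ has the Chevalley property, that is, the tensor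 product of any two finite-dimensional irreducible $H/\mathfrak m_{\overline\varepsilon}H$-modules is completely reducible. Write $\mathrm{Irr}(H/\mathfrak m_{\overline\varepsilon}H)=\{[V_1],\dots,[V_m]\}$. Then for every maximal ideal $\mathfrak m$ of $C$ the following hold. 1. $\mathrm{Sd}(\mathfrak m)\ \ge\ \mathrm{Sd}(\mathfrak m_{\overline\varepsilon})\ \ge\ |\mathrm{Irr}(H/\mathfrak mH)|$. 2. The following are equivalent: (i) $\mathrm{Sd}(\mathfrak m)=\mathrm{Sd}(\mathfrak m_{\overline\varepsilon})$; (ii) for every irreducible $H/\mathfrak mH$-module $W$, as $H$-modules, $$W\otimes W^*\cong\bigoplus_{i=1}^m V_i^{\oplus \dim_\Bbbk \mathrm{Hom}_H(V_i\otimes W,\,W)};$$ (iii) for every irreducible $H/\mathfrak mH$-module $W$, the $H/\mathfrak m_{\overline\varepsilon}H$-module $W\otimes W^*$ is completely reducible. -/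

import Mathlib

universe u v w w'

open scoped TensorProduct

/-- A left module over a `k`-algebra `A`, together with its underlying `k`-vector space. -/
structure AlgModule (k : Type u) (A : Type v) [Field k] [Ring A] [Algebra k A] where
  carrier : Type w
  [addCommGroup : AddCommGroup carrier]
  [moduleBase : Module k carrier]
  [moduleAlg : Module A carrier]
  [isScalarTower : IsScalarTower k A carrier]

namespace AlgModule

instance {k : Type u} {A : Type v} [Field k] [Ring A] [Algebra k A] :
    CoeSort (AlgModule.{u, v, w} k A) (Type w) := ⟨AlgModule.carrier⟩

attribute [instance] addCommGroup moduleBase moduleAlg isScalarTower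

/-- The module defined by a representation `A → End_k(M)`. -/
def ofAlgHom {k : Type u} {A : Type v} [Field k] [Ring A] [Algebra k A]
    {M : Type w} [AddCommGroup M] [Module k M] (ρ : A →ₐ[k] Module.End k M) :
    AlgModule.{u, v, w} k A :=
  letI : Module A M := Module.compHom M ρ.toRingHom
  { carrier := M
    isScalarTower := ⟨fun r a x => by
      change ρ (r • a) x = r • ρ a x
      rw [map_smul, LinearMap.smul_apply]⟩ }

/-- Restriction of scalars along an algebra homomorphism `A → B`. -/
def restrict {k : Type u} {A : Type v} {B : Type w'} [Field k] [Ring A] [Algebra k A]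
    [Ring B] [Algebra k B] (f : A →ₐ[k] B) (M : AlgModule.{u, w', w} k B) :
    AlgModule.{u, v, w} k A :=
  ofAlgHom ((Algebra.lsmul k k M).comp f)

/-- A module annihilated by a two-sided ideal `I`, viewed as a module over the quotient by `I`. -/
def descend {k : Type u} {A : Type v} [Field k] [Ring A] [Algebra k A]
    (M : AlgModule.{u, v, w} k A) (I : Ideal A) [I.IsTwoSided]
    (h : ∀ a ∈ I, ∀ x : M, a • x = 0) : AlgModule.{u, v, w} k (A ⧸ I) :=
  ofAlgHom (Ideal.Quotient.liftₐ I (Algebra.lsmul k k M)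
    fun a ha => LinearMap.ext fun x => h a ha x)

/-- The tensor product of two modules over a bialgebra, with `h (v ⊗ w) = ∑ h₁ v ⊗ h₂ w`. -/
noncomputable def tensor {k : Type u} {A : Type v} [Field k] [Ring A] [Bialgebra k A]
    (V : AlgModule.{u, v, w} k A) (W : AlgModule.{u, v, w'} k A) :
    AlgModule.{u, v, max w w'} k A :=
  ofAlgHom (M := V ⊗[k] W)
    ((Module.endTensorEndAlgHom (R := k) (A := k) (M := V) (N := W)).comp
      ((Algebra.TensorProduct.map (Algebra.lsmul k k V) (Algebra.lsmul k k W)).comp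
        (Bialgebra.comulAlgHom k A)))

/-- The representation `(h ξ)(x) = ξ (S(h) x)` on the dual space. -/
noncomputable def dualAction {k : Type u} {A : Type v} [Field k] [Ring A] [HopfAlgebra k A]
    (V : AlgModule.{u, v, w} k A) : A →ₐ[k] Module.End k (Module.Dual k V) :=
  AlgHom.ofLinearMap
    (Module.Dual.transpose (R := k) (M := V) (M' := V) ∘ₗ (Algebra.lsmul k k V).toLinearMap ∘ₗ
      HopfAlgebra.antipode k)
    (by ext; simp [Module.Dual.transpose])
    (fun a b => by
      ext
      simp [Module.Dual.transpose, HopfAlgebra.antipode_mul_antidistrib])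

/-- The left dual `V*` of a module over a Hopf algebra. -/
noncomputable def dual {k : Type u} {A : Type v} [Field k] [Ring A] [HopfAlgebra k A]
    (V : AlgModule.{u, v, w} k A) : AlgModule.{u, v, max u w} k A :=
  ofAlgHom V.dualAction

end AlgModule

/-- Isomorphism of `A`-modules, as an equivalence relation on the irreducible `A`-modules. -/
def irrSetoid (k : Type u) (A : Type v) [Field k] [Ring A] [Algebra k A] :
    Setoid {V : AlgModule.{u, v, v} k A // IsSimpleModule A V} where
  r V W := Nonempty (V.1 ≃ₗ[A] W.1)
  iseqv :=
    { refl := fun _ => ⟨LinearEquiv.refl _ _⟩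
      symm := fun ⟨e⟩ => ⟨e.symm⟩
      trans := fun ⟨e⟩ ⟨f⟩ => ⟨e.trans f⟩ }

/-- `Irr(A)`, the isomorphism classes of irreducible `A`-modules. Every irreducible `A`-module is
isomorphic to a quotient of `A`, so that one may take the modules in the universe of `A`. -/
def Irr (k : Type u) (A : Type v) [Field k] [Ring A] [Algebra k A] : Type (max u (v + 1)) :=
  Quotient (irrSetoid k A)

/-- An irreducible module in a given isomorphism class. -/
noncomputable def Irr.rep {k : Type u} {A : Type v} [Field k] [Ring A] [Algebra k A]
    (X : Irr k A) : AlgModule.{u, v, v} k A :=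
  (Quotient.out X).1

/-- The sum of the squares of the dimensions of the irreducible `A`-modules. -/
noncomputable def sqDim (k : Type u) (A : Type v) [Field k] [Ring A] [Algebra k A] : ℕ :=
  ∑ᶠ X : Irr k A, Module.finrank k X.rep ^ 2

/-- The Chevalley property: the tensor product of any two finite-dimensional irreducible modules
is completely reducible. -/
def HasChevalleyProperty (k : Type u) (A : Type v) [Field k] [Ring A] [HopfAlgebra k A] : Prop :=
  ∀ V W : AlgModule.{u, v, v} k A, Module.Finite k V → Module.Finite k W →
    IsSimpleModule A V → IsSimpleModule A W → IsSemisimpleModule A (V.tensor W)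

/-- A central Hopf subalgebra of a Hopf algebra `H`. -/
structure CentralHopfSubalgebra (k : Type u) (H : Type v) [Field k] [Ring H] [HopfAlgebra k H]
    extends Subalgebra k H where
  central : ∀ c ∈ toSubalgebra, ∀ h : H, c * h = h * c
  comul_mem : ∀ c ∈ toSubalgebra, Coalgebra.comul (R := k) c ∈
    LinearMap.range (TensorProduct.map toSubalgebra.val.toLinearMap toSubalgebra.val.toLinearMap)
  antipode_mem : ∀ c ∈ toSubalgebra, HopfAlgebra.antipode k c ∈ toSubalgebra

namespace CentralHopfSubalgebra

section fiber

variable {k : Type u} {H : Type v} [Field k] [Ring H] [HopfAlgebra k H]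
  (C : CentralHopfSubalgebra k H)

/-- The ideal `𝔪H` of `H` generated by an ideal `𝔪` of `C`. -/
def fiberIdeal (𝔪 : Ideal C.toSubalgebra) : Ideal H :=
  Ideal.span (Subtype.val '' (𝔪 : Set C.toSubalgebra))

instance (𝔪 : Ideal C.toSubalgebra) : (C.fiberIdeal 𝔪).IsTwoSided := by
  refine ⟨fun {a} b ha => ?_⟩
  induction ha using Submodule.span_induction with
  | mem x hx =>
    obtain ⟨c, hc, rfl⟩ := hx
    rw [C.central c c.2 b]
    exact Ideal.mul_mem_left _ _ (Ideal.subset_span ⟨c, hc, rfl⟩)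
  | zero => simp
  | add x y _ _ hx hy => rw [add_mul]; exact add_mem hx hy
  | smul a x _ hx => rw [smul_eq_mul, mul_assoc]; exact Ideal.mul_mem_left _ _ hx

/-- The fiber algebra `H/𝔪H`. -/
abbrev Fiber (𝔪 : Ideal C.toSubalgebra) : Type v := H ⧸ C.fiberIdeal 𝔪

/-- The kernel of the counit of `C`. -/
def counitIdeal : Ideal C.toSubalgebra :=
  RingHom.ker ((Bialgebra.counitAlgHom k H).comp C.toSubalgebra.val)

theorem mem_counitIdeal (c : C.toSubalgebra) :
    c ∈ C.counitIdeal ↔ Coalgebra.counit (R := k) (c : H) = 0 := Iff.rfl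

theorem sub_counit_mem (c : C.toSubalgebra) :
    (c : H) - algebraMap k H (Coalgebra.counit (R := k) (c : H)) ∈
      C.fiberIdeal C.counitIdeal := by
  refine Ideal.subset_span
    ⟨c - algebraMap k _ (Coalgebra.counit (R := k) (c : H)), ?_, by simp⟩
  simp [mem_counitIdeal]

theorem mk_eq_counit (c : C.toSubalgebra) :
    Ideal.Quotient.mkₐ k (C.fiberIdeal C.counitIdeal) (c : H) =
      algebraMap k _ (Coalgebra.counit (R := k) (c : H)) := by
  rw [← (Ideal.Quotient.mkₐ k (C.fiberIdeal C.counitIdeal)).commutes]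
  exact Ideal.Quotient.eq.2 (C.sub_counit_mem c)

theorem mk_map_comul (c : C.toSubalgebra) :
    Algebra.TensorProduct.map (Ideal.Quotient.mkₐ k (C.fiberIdeal C.counitIdeal))
      (Ideal.Quotient.mkₐ k (C.fiberIdeal C.counitIdeal)) (Coalgebra.comul (R := k) (c : H)) =
      algebraMap k _ (Coalgebra.counit (R := k) (c : H)) := by
  obtain ⟨t, ht⟩ := C.comul_mem c c.2
  have key : ∀ t : C.toSubalgebra ⊗[k] C.toSubalgebra,
      Algebra.TensorProduct.map (Ideal.Quotient.mkₐ k (C.fiberIdeal C.counitIdeal))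
        (Ideal.Quotient.mkₐ k (C.fiberIdeal C.counitIdeal))
        (TensorProduct.map C.toSubalgebra.val.toLinearMap C.toSubalgebra.val.toLinearMap t) =
      (1 : C.Fiber C.counitIdeal) ⊗ₜ[k] Ideal.Quotient.mkₐ k (C.fiberIdeal C.counitIdeal)
        (TensorProduct.lid k H ((Coalgebra.counit (R := k) (A := H)).rTensor H
        (TensorProduct.map C.toSubalgebra.val.toLinearMap C.toSubalgebra.val.toLinearMap t))) := by
    intro t
    induction t with
    | zero => simp
    | add x y hx hy => simp only [map_add, hx, hy, TensorProduct.tmul_add]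
    | tmul a b =>
      have h1 := C.mk_eq_counit a
      rw [TensorProduct.map_tmul, Algebra.TensorProduct.map_tmul, AlgHom.toLinearMap_apply,
        AlgHom.toLinearMap_apply, Subalgebra.coe_val, h1, LinearMap.rTensor_tmul,
        TensorProduct.lid_tmul, map_smul, Algebra.algebraMap_eq_smul_one,
        TensorProduct.smul_tmul]
  rw [← ht, key, ht, Coalgebra.rTensor_counit_comul, TensorProduct.lid_tmul, one_smul,
    C.mk_eq_counit, ← Algebra.TensorProduct.algebraMap_apply']

instance : (C.fiberIdeal C.counitIdeal).IsHopfIdeal k where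
  counit_eq_zero := by
    intro x hx
    have h : C.fiberIdeal C.counitIdeal ≤ RingHom.ker (Bialgebra.counitAlgHom k H) := by
      refine Ideal.span_le.2 ?_
      rintro _ ⟨c, hc, rfl⟩
      exact hc
    exact h hx
  map_mkQ_comul_eq_zero := by
    intro x hx
    have h : C.fiberIdeal C.counitIdeal ≤ RingHom.ker
        ((Algebra.TensorProduct.map (Ideal.Quotient.mkₐ k (C.fiberIdeal C.counitIdeal))
          (Ideal.Quotient.mkₐ k (C.fiberIdeal C.counitIdeal))).comp
          (Bialgebra.comulAlgHom k H)) := by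
      refine Ideal.span_le.2 ?_
      rintro _ ⟨c, hc, rfl⟩
      have h0 : Coalgebra.counit (R := k) (c : H) = 0 := hc
      have := C.mk_map_comul c
      rw [h0, map_zero] at this
      exact this
    exact h hx
  antipode_mem := by
    intro x hx
    induction hx using Submodule.span_induction with
    | mem x hx =>
      obtain ⟨c, hc, rfl⟩ := hx
      refine Ideal.subset_span ⟨⟨_, C.antipode_mem c c.2⟩, ?_, rfl⟩
      change Coalgebra.counit (R := k) (HopfAlgebra.antipode k (c : H)) = 0
      rw [HopfAlgebra.counit_antipode]
      exact hc
    | zero => simp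
    | add x y _ _ hx hy => rw [map_add]; exact add_mem hx hy
    | smul a x _ hx =>
      rw [smul_eq_mul, HopfAlgebra.antipode_mul_antidistrib]
      exact Ideal.mul_mem_right _ _ hx

/-- The square dimension function `Sd`. -/
noncomputable def Sd (𝔪 : Ideal C.toSubalgebra) : ℕ := sqDim k (C.Fiber 𝔪)

/-- A module over the fiber algebra `H/𝔪H`, viewed as an `H`-module. -/
def inflate {𝔪 : Ideal C.toSubalgebra} (W : AlgModule.{u, v, w} k (C.Fiber 𝔪)) :
    AlgModule.{u, v, w} k H :=
  W.restrict (Ideal.Quotient.mkₐ k (C.fiberIdeal 𝔪))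

end fiber

section residue

variable {k : Type u} {H : Type v} [Field k] [IsAlgClosed k] [Ring H] [HopfAlgebra k H]
  [Algebra.FiniteType k H] (C : CentralHopfSubalgebra k H) [Module.Finite C.toSubalgebra H]

/-- The residue field of `C` at a maximal ideal is `k`. -/
theorem exists_sub_algebraMap_mem (𝔪 : Ideal C.toSubalgebra) (h𝔪 : 𝔪.IsMaximal)
    (c : C.toSubalgebra) : ∃ r : k, c - algebraMap k C.toSubalgebra r ∈ 𝔪 := by
  let : CommRing C.toSubalgebra :=
    { (inferInstance : Ring C.toSubalgebra) with
      mul_comm := fun a b => Subtype.ext (C.central a a.2 b) }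
  let : Algebra C.toSubalgebra H :=
    { (inferInstance : Module C.toSubalgebra H) with
      algebraMap := C.toSubalgebra.val.toRingHom
      commutes' := fun a h => C.central a a.2 h
      smul_def' := fun _ _ => rfl }
  have : IsScalarTower k C.toSubalgebra H := inferInstance
  obtain ⟨B, hB, hBH⟩ := exists_subalgebra_of_fg k C.toSubalgebra H
    (Algebra.FiniteType.out (R := k) (A := H)) (Module.Finite.fg_top (R := C.toSubalgebra) (M := H))
  have : IsNoetherianRing B := isNoetherianRing_of_fg hB
  have : Module.Finite B H := ⟨hBH⟩
  have : IsScalarTower B C.toSubalgebra H := inferInstance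
  have hfin : (⊤ : Submodule B C.toSubalgebra).FG :=
    fg_of_injective (IsScalarTower.toAlgHom B C.toSubalgebra H).toLinearMap Subtype.val_injective
  have : Algebra.FiniteType k C.toSubalgebra :=
    ⟨Algebra.fg_trans' (B.fg_top.2 hB) (Subalgebra.fg_of_submodule_fg hfin)⟩
  let := Ideal.Quotient.field 𝔪
  have : Algebra.FiniteType k (C.toSubalgebra ⧸ 𝔪) := inferInstance
  have : Module.Finite k (C.toSubalgebra ⧸ 𝔪) := finite_of_finite_type_of_isJacobsonRing _ _
  obtain ⟨r, hr⟩ := (IsAlgClosed.algebraMap_bijective_of_isIntegral (k := k)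
    (K := C.toSubalgebra ⧸ 𝔪)).2 (Ideal.Quotient.mk 𝔪 c)
  exact ⟨r, Ideal.Quotient.eq.1 hr.symm⟩

theorem tensor_dual_annihilated (𝔪 : Ideal C.toSubalgebra) (h𝔪 : 𝔪.IsMaximal)
    (W : AlgModule.{u, v, w} k (C.Fiber 𝔪)) :
    ∀ h ∈ C.fiberIdeal C.counitIdeal, ∀ x : (C.inflate W).tensor (C.inflate W).dual,
      h • x = 0 := by
  set M := C.inflate W with hM
  have hscal : ∀ c : C.toSubalgebra, ∃ r : k, ∀ x : M, (c : H) • x = r • x := by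
    intro c
    obtain ⟨r, hr⟩ := C.exists_sub_algebraMap_mem 𝔪 h𝔪 c
    refine ⟨r, fun x => ?_⟩
    have h0 : Ideal.Quotient.mkₐ k (C.fiberIdeal 𝔪) ((c : H) - algebraMap k H r) = 0 :=
      Ideal.Quotient.eq_zero_iff_mem.2 (Ideal.subset_span ⟨_, hr, by simp⟩)
    have h1 : ((c : H) - algebraMap k H r) • x = 0 := by
      change Ideal.Quotient.mkₐ k (C.fiberIdeal 𝔪) ((c : H) - algebraMap k H r) •
        (show W from x) = 0
      rw [h0, zero_smul]
    rw [sub_smul, sub_eq_zero, algebraMap_smul] at h1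
    exact h1
  have key : ∀ (t : C.toSubalgebra ⊗[k] C.toSubalgebra) (x : M) (ξ : Module.Dual k M),
      Module.endTensorEndAlgHom (R := k) (S := k) (A := k) (M := M) (N := Module.Dual k M)
        (Algebra.TensorProduct.map (S := k) (Algebra.lsmul (A := H) k k M) M.dualAction
          (TensorProduct.map C.toSubalgebra.val.toLinearMap C.toSubalgebra.val.toLinearMap t))
        (x ⊗ₜ[k] ξ) =
      x ⊗ₜ[k] (ξ ∘ₗ Algebra.lsmul (A := H) k k M (LinearMap.mul' k H
        ((HopfAlgebra.antipode k).lTensor H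
          (TensorProduct.map C.toSubalgebra.val.toLinearMap C.toSubalgebra.val.toLinearMap t)))) := by
    intro t x ξ
    induction t with
    | zero => simp
    | add a b ha hb =>
      simp only [map_add, LinearMap.add_apply, ha, hb, LinearMap.comp_add, TensorProduct.tmul_add]
    | tmul a b =>
      obtain ⟨r, hr⟩ := hscal a
      have e1 : Algebra.lsmul (A := H) k k M (a : H) x = r • x := hr x
      have e2 : M.dualAction (b : H) ξ =
          ξ ∘ₗ Algebra.lsmul (A := H) k k M (HopfAlgebra.antipode k (b : H)) := rfl
      have e3 : Algebra.lsmul (A := H) k k M ((a : H) * HopfAlgebra.antipode k (b : H)) =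
          r • Algebra.lsmul (A := H) k k M (HopfAlgebra.antipode k (b : H)) := by
        ext y
        simp [hr]
      simp only [TensorProduct.map_tmul, Algebra.TensorProduct.map_tmul, AlgHom.toLinearMap_apply,
        Subalgebra.coe_val, Module.endTensorEndAlgHom_apply,
        TensorProduct.AlgebraTensorModule.map_tmul, LinearMap.lTensor_tmul,
        LinearMap.mul'_apply, e1, e2, e3, LinearMap.comp_smul, TensorProduct.tmul_smul,
        TensorProduct.smul_tmul']
  have hgen : ∀ c : C.toSubalgebra, c ∈ C.counitIdeal → ∀ x : M.tensor M.dual, (c : H) • x = 0 := by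
    intro c hc x
    obtain ⟨t, ht⟩ := C.comul_mem c c.2
    have h0 : Coalgebra.counit (R := k) (c : H) = 0 := hc
    change Module.endTensorEndAlgHom (R := k) (S := k) (A := k) (M := M) (N := Module.Dual k M)
        (Algebra.TensorProduct.map (S := k) (Algebra.lsmul (A := H) k k M) M.dualAction
          (Coalgebra.comul (R := k) (c : H))) (show M ⊗[k] Module.Dual k M from x) = 0
    generalize (show M ⊗[k] Module.Dual k M from x) = y
    induction y with
    | zero => simp
    | add a b ha hb => rw [map_add, ha, hb, add_zero]
    | tmul a b =>
      rw [← ht, key, ht, HopfAlgebra.mul_antipode_lTensor_comul_apply, h0]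
      simp
  intro h hh
  induction hh using Submodule.span_induction with
  | mem x hx => obtain ⟨c, hc, rfl⟩ := hx; exact hgen c hc
  | zero => simp
  | add x y _ _ hx hy => intro z; rw [add_smul, hx, hy, add_zero]
  | smul a x _ hx => intro z; rw [smul_eq_mul, mul_smul, hx, smul_zero]

/-- For a module `W` over the fiber algebra at a maximal ideal, `W ⊗ W*` as a module over the
identity fiber algebra. -/
noncomputable def tensorDual {𝔪 : Ideal C.toSubalgebra} (h𝔪 : 𝔪.IsMaximal)
    (W : AlgModule.{u, v, w} k (C.Fiber 𝔪)) :
    AlgModule.{u, v, max u w} k (C.Fiber C.counitIdeal) :=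
  ((C.inflate W).tensor (C.inflate W).dual).descend (C.fiberIdeal C.counitIdeal)
    (C.tensor_dual_annihilated 𝔪 h𝔪 W)

end residue

end CentralHopfSubalgebra

/-!
Let `J` be the preimage in `H` of the Jacobson radical of the identity fiber, and `R = H/J`. By the
Chevalley property `J` is a coideal (`CentralHopfSubalgebra.isCoideal_radIdeal`), so that `J`
annihilates tensor products of modules annihilated by `J`. Also `dim R = Sd(𝔪_ε)`. For irreducible
modules `W`, `U` over the fiber at `𝔪` the adjunction between `⊗` and `Hom_k`
(`AlgModule.curryEquiv`) identifies `Hom_H(R ⊗ W, U)` with the subspace of vectors annihilated by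
`J` in `Hom_k(W, U)`, which is a module over the identity fiber. Let `h(W, U)` be its dimension; thus
`1 ≤ h(W, U) ≤ dim W dim U`, and `h(W, W) = (dim W)²` holds exactly if `J` annihilates
`Hom_k(W, W) ≅ W ⊗ W*`, that is, if `W ⊗ W*` is completely reducible.

Everything follows from the formula `h(W, U) Sd(𝔪) = Sd(𝔪_ε) dim W dim U`
(`CentralHopfSubalgebra.finrank_radTensor_hom_mul_Sd`). The upper bound on `h(W, W)` gives
`Sd(𝔪_ε) ≤ Sd(𝔪)`, with equality exactly if all `W ⊗ W*` are completely reducible; summing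
`1 ≤ h(U, U)` over all `U` gives `|Irr| ≤ Sd(𝔪_ε)`. If `W ⊗ W*` is completely reducible, the
multiplicity of `V` in it is `dim Hom_H(V, W ⊗ W*) = dim Hom_H(V ⊗ W, W)`.

The formula holds because some power of `R ⊗ W` is free over the semisimple quotient `A/Jac(A)` of
the fiber `A` (`finrank_hom_mul_sqDim`). Choose `U` such that `h(W, U) / dim U` is maximal. Then the
head of `M = (R ⊗ W)^(dim U)` is a quotient of `(A/Jac(A))^r` with `r = h(W, U)`, so `M` is
generated by `r` elements. On the other hand `R ⊗ Hom_k(W, U)` embeds into `Hom_k(W, R ⊗ U)`, which shows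
that `M` has at least `r dim(R ⊗ U)` independent homomorphisms to `R ⊗ U`
(`AlgModule.finrank_quot_mul_le`). Hence the images of the `r` generators can be prescribed
arbitrarily, and all coefficients of a relation between them annihilate `R ⊗ U`. The annihilator `I`
of `R ⊗ U` does not depend on `U` (`AlgModule.smul_quot_tensor_of_surjective`), so `M ≅ (A/I)^r`.
Finally `R` is semisimple, so the trivial module is a direct summand of `R` and `W` is one of
`R ⊗ W`. Therefore every irreducible module is projective over `A/I`, which forces `I = Jac(A)`
(`jacobson_le_of_retract`).
-/

/-! ### Irreducible modules over a finite-dimensional algebra -/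

section FiniteDimensionalAlgebra

variable {k : Type u} {A : Type v} [Field k] [Ring A] [Algebra k A]

instance Irr.isSimpleModule_rep (X : Irr k A) : IsSimpleModule A X.rep := (Quotient.out X).2

theorem Irr.exists_linearEquiv_rep {S : Type w} [AddCommGroup S] [Module A S]
    [IsSimpleModule A S] : ∃ X : Irr k A, Nonempty (S ≃ₗ[A] X.rep) := by
  obtain ⟨I, hI, ⟨e⟩⟩ := isSimpleModule_iff_quot_maximal.mp (inferInstance : IsSimpleModule A S)
  let V : AlgModule.{u, v, v} k A := { carrier := A ⧸ I }
  have hV : IsSimpleModule A V := IsSimpleModule.congr e.symm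
  obtain ⟨f⟩ : Nonempty ((Quotient.out (Quotient.mk (irrSetoid k A) ⟨V, hV⟩)).1 ≃ₗ[A] V) :=
    Quotient.exact (Quotient.out_eq (Quotient.mk (irrSetoid k A) ⟨V, hV⟩))
  exact ⟨Quotient.mk (irrSetoid k A) ⟨V, hV⟩, ⟨e.trans f.symm⟩⟩

theorem Irr.eq_of_linearEquiv {X Y : Irr k A} (e : X.rep ≃ₗ[A] Y.rep) : X = Y := by
  rw [← Quotient.out_eq X, ← Quotient.out_eq Y]
  exact Quotient.sound ⟨e⟩

instance Irr.finite_rep [Module.Finite k A] (X : Irr k A) : Module.Finite k X.rep :=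
  Module.Finite.trans A X.rep

theorem Irr.finrank_rep_pos [Module.Finite k A] (X : Irr k A) : 0 < Module.finrank k X.rep := by
  have := IsSimpleModule.nontrivial A X.rep
  exact Module.finrank_pos

theorem Module.Finite.linearMap_restrict {M : Type*} {N : Type*} [AddCommGroup M] [Module k M]
    [Module A M] [IsScalarTower k A M] [AddCommGroup N] [Module k N] [Module A N]
    [IsScalarTower k A N] [Module.Finite k M] [Module.Finite k N] : Module.Finite k (M →ₗ[A] N) :=
  .of_injective (LinearMap.restrictScalarsₗ k A M N k) (LinearMap.restrictScalars_injective _)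

open Classical in
/-- Schur's lemma. -/
theorem Irr.finrank_hom_rep [IsAlgClosed k] [Module.Finite k A] (X Y : Irr k A) :
    Module.finrank k (X.rep →ₗ[A] Y.rep) = if X = Y then 1 else 0 := by
  split_ifs with h
  · subst h
    have hb := IsSimpleModule.algebraMap_end_bijective_of_isAlgClosed (A := A) (V := X.rep) k
    have e := LinearEquiv.ofBijective (Algebra.linearMap k (Module.End A X.rep)) hb
    rw [← e.finrank_eq, Module.finrank_self]
  · have : Subsingleton (X.rep →ₗ[A] Y.rep) := by
      refine ⟨fun f g => ?_⟩
      have : ∀ f : X.rep →ₗ[A] Y.rep, f = 0 := fun f => by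
        by_contra hf
        exact h (Irr.eq_of_linearEquiv
          (LinearEquiv.ofBijective f (LinearMap.bijective_of_ne_zero hf)))
      rw [this f, this g]
    exact Module.finrank_zero_of_subsingleton

variable (k) in
theorem IsSemisimpleModule.exists_linearEquiv_pi_rep (A : Type v) [Ring A] [Algebra k A]
    (M : Type w) [AddCommGroup M] [Module A M]
    [IsSemisimpleModule A M] [Module.Finite A M] :
    ∃ (n : ℕ) (X : Fin n → Irr k A), Nonempty (M ≃ₗ[A] ∀ i, (X i).rep) := by
  obtain ⟨n, S, e, hS⟩ := IsSemisimpleModule.exists_linearEquiv_fin_dfinsupp A M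
  choose X f using fun i => Irr.exists_linearEquiv_rep (k := k) (A := A) (S := S i)
  exact ⟨n, X, ⟨(e.trans DFinsupp.linearEquivFunOnFintype).trans
    (LinearEquiv.piCongrRight fun i => (f i).some)⟩⟩

/-- A module annihilated by the Jacobson radical is a module over the semisimple ring
`A/Jac(A)`. -/
theorem isSemisimpleModule_of_jacobson_smul [Module.Finite k A] {M : Type w} [AddCommGroup M]
    [Module A M] (h : ∀ a ∈ Ring.jacobson A, ∀ x : M, a • x = 0) : IsSemisimpleModule A M := by
  have := IsArtinianRing.of_finite k A
  have hM : Module.IsTorsionBySet A M (Ring.jacobson A) := fun x a => h a a.2 x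
  let := hM.module
  exact hM.isSemisimpleModule_iff.1 inferInstance

theorem jacobson_smul_of_isSemisimpleModule {M : Type w} [AddCommGroup M]
    [Module A M] [IsSemisimpleModule A M] {a : A} (ha : a ∈ Ring.jacobson A) (x : M) :
    a • x = 0 :=
  Module.mem_annihilator.1 (IsSemisimpleModule.jacobson_le_annihilator A M ha) x

theorem finrank_hom_congr_left {M : Type w} [AddCommGroup M] [Module A M]
    {M' : Type w'} [AddCommGroup M'] [Module A M'] (e : M ≃ₗ[A] M')
    (N : Type*) [AddCommGroup N] [Module k N] [Module A N] [IsScalarTower k A N] :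
    Module.finrank k (M →ₗ[A] N) = Module.finrank k (M' →ₗ[A] N) :=
  (LinearEquiv.congrLeft N k e).finrank_eq

theorem finrank_hom_congr_right {M : Type w} [AddCommGroup M] [Module k M] [Module A M]
    [IsScalarTower k A M] {M' : Type w'} [AddCommGroup M'] [Module k M'] [Module A M']
    [IsScalarTower k A M'] (e : M ≃ₗ[A] M') (N : Type*) [AddCommGroup N] [Module A N] :
    Module.finrank k (N →ₗ[A] M) = Module.finrank k (N →ₗ[A] M') :=
  LinearEquiv.finrank_eq
    { toFun := fun f => e.toLinearMap ∘ₗ f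
      invFun := fun f => e.symm.toLinearMap ∘ₗ f
      map_add' := fun f g => by ext; simp
      map_smul' := fun r f => by
        ext x
        exact (e.restrictScalars k).map_smul r (f x)
      left_inv := fun f => by ext; simp
      right_inv := fun f => by ext; simp }

theorem finrank_quotient_hom (I : Ideal A) (M : Type w) [AddCommGroup M] [Module k M] [Module A M]
    [IsScalarTower k A M] (hI : ∀ a ∈ I, ∀ x : M, a • x = 0) :
    Module.finrank k ((A ⧸ I) →ₗ[A] M) = Module.finrank k M :=
  LinearEquiv.finrank_eq
    { toFun := fun f => f (Submodule.Quotient.mk 1)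
      invFun := fun x => Submodule.liftQ I (LinearMap.toSpanSingleton A M x)
        fun a ha => by simpa using hI a ha x
      map_add' := fun f g => rfl
      map_smul' := fun r f => rfl
      left_inv := fun f => by
        refine Submodule.linearMap_qext _ (LinearMap.ext_ring ?_)
        simp
      right_inv := fun x => by simp }

variable (k) in
theorem isSemisimpleModule_quotient_jacobson (A : Type v) [Ring A] [Algebra k A]
    [Module.Finite k A] :
    IsSemisimpleModule A (A ⧸ Ring.jacobson A) :=
  isSemisimpleModule_of_jacobson_smul (k := k) fun a ha x => by
    obtain ⟨b, rfl⟩ := Ideal.Quotient.mk_surjective x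
    exact Ideal.Quotient.eq_zero_iff_mem.2 (Ideal.mul_mem_right b _ ha)

theorem finrank_jacobson_quotient_hom (X : Irr k A) :
    Module.finrank k ((A ⧸ Ring.jacobson A) →ₗ[A] X.rep) = Module.finrank k X.rep :=
  finrank_quotient_hom _ _ fun _ ha x => jacobson_smul_of_isSemisimpleModule ha x

variable [IsAlgClosed k] [Module.Finite k A]

open Classical in
theorem finrank_pi_rep_hom {n : ℕ} (X : Fin n → Irr k A) (Y : Irr k A) :
    Module.finrank k ((∀ i, (X i).rep) →ₗ[A] Y.rep) = Fintype.card {i // X i = Y} := by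
  have := fun i => Module.Finite.linearMap_restrict (k := k) (A := A) (M := (X i).rep) (N := Y.rep)
  rw [← (LinearMap.lsum A (fun i => (X i).rep) k).finrank_eq, Module.finrank_pi_fintype]
  simp_rw [Irr.finrank_hom_rep, Fintype.card_subtype, Finset.card_filter]

open Classical in
theorem finrank_hom_pi_rep {n : ℕ} (X : Fin n → Irr k A) (Y : Irr k A) :
    Module.finrank k (Y.rep →ₗ[A] (∀ i, (X i).rep)) = Fintype.card {i // X i = Y} := by
  have := fun i => Module.Finite.linearMap_restrict (k := k) (A := A) (M := Y.rep) (N := (X i).rep)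
  let e : (∀ i, Y.rep →ₗ[A] (X i).rep) ≃ₗ[k] (Y.rep →ₗ[A] (∀ i, (X i).rep)) :=
    { toFun := fun f => LinearMap.pi f
      invFun := fun f i => LinearMap.proj i ∘ₗ f
      map_add' := fun _ _ => rfl
      map_smul' := fun _ _ => rfl
      left_inv := fun _ => rfl
      right_inv := fun _ => rfl }
  rw [← e.finrank_eq, Module.finrank_pi_fintype]
  simp_rw [Irr.finrank_hom_rep, eq_comm (a := Y), Fintype.card_subtype, Finset.card_filter]

section

variable (M : Type w) [AddCommGroup M] [Module k M] [Module A M] [IsScalarTower k A M]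

variable [IsSemisimpleModule A M] [Module.Finite A M]

theorem finrank_hom_rep_comm (Y : Irr k A) :
    Module.finrank k (Y.rep →ₗ[A] M) = Module.finrank k (M →ₗ[A] Y.rep) := by
  obtain ⟨n, X, ⟨e⟩⟩ := IsSemisimpleModule.exists_linearEquiv_pi_rep k A M
  rw [finrank_hom_congr_right e, finrank_hom_congr_left e, finrank_hom_pi_rep, finrank_pi_rep_hom]

/-- The isotypic decomposition of a completely reducible module. -/
theorem IsSemisimpleModule.nonempty_linearEquiv_isotypic :
    Nonempty (M ≃ₗ[A] ∀ V : Irr k A, Fin (Module.finrank k (V.rep →ₗ[A] M)) → V.rep) := by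
  classical
  obtain ⟨n, X, ⟨e⟩⟩ := IsSemisimpleModule.exists_linearEquiv_pi_rep k A M
  have hcard : ∀ V : Irr k A,
      Fintype.card {i // X i = V} = Fintype.card (Fin (Module.finrank k (V.rep →ₗ[A] M))) := by
    intro V
    rw [finrank_hom_congr_right e, finrank_hom_pi_rep, Fintype.card_fin]
  let f (V : Irr k A) := Fintype.equivOfCardEq (hcard V)
  let g : (∀ i, (X i).rep) ≃ₗ[A] ∀ V : Irr k A, {i // X i = V} → V.rep :=
    { toFun := fun x V j => j.2 ▸ x j.1
      invFun := fun y i => y (X i) ⟨i, rfl⟩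
      map_add' := fun x y => by
        ext V ⟨j, rfl⟩
        rfl
      map_smul' := fun a x => by
        ext V ⟨j, rfl⟩
        rfl
      left_inv := fun x => rfl
      right_inv := fun y => by
        ext V ⟨j, rfl⟩
        rfl }
  exact ⟨(e.trans g).trans (LinearEquiv.piCongrRight fun V =>
    LinearEquiv.funCongrLeft A V.rep (f V).symm)⟩

end

variable (k A)

instance Irr.finite : Finite (Irr k A) := by
  have := isSemisimpleModule_quotient_jacobson k A
  obtain ⟨n, X, ⟨e⟩⟩ := IsSemisimpleModule.exists_linearEquiv_pi_rep k A (A ⧸ Ring.jacobson A)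
  refine Finite.of_surjective X fun Y => ?_
  classical
  have h := finrank_jacobson_quotient_hom Y
  rw [finrank_hom_congr_left e, finrank_pi_rep_hom] at h
  have hpos := Y.finrank_rep_pos
  rw [← h, Fintype.card_pos_iff] at hpos
  exact ⟨hpos.some.1, hpos.some.2⟩

theorem nonempty_quotient_jacobson_equiv : Nonempty ((A ⧸ Ring.jacobson A) ≃ₗ[A]
    ∀ V : Irr k A, Fin (Module.finrank k V.rep) → V.rep) := by
  have := isSemisimpleModule_quotient_jacobson k A
  obtain ⟨e⟩ := IsSemisimpleModule.nonempty_linearEquiv_isotypic (k := k) (A := A)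
    (A ⧸ Ring.jacobson A)
  have h (V : Irr k A) : Module.finrank k V.rep =
      Module.finrank k (V.rep →ₗ[A] (A ⧸ Ring.jacobson A)) := by
    rw [finrank_hom_rep_comm (k := k) (A := A), finrank_jacobson_quotient_hom]
  exact ⟨e.trans (LinearEquiv.piCongrRight fun V =>
    LinearEquiv.funCongrLeft A V.rep (finCongr (h V)))⟩

/-- `dim A/Jac(A)` is the sum of the squares of the dimensions of the irreducible modules. -/
theorem finrank_quotient_jacobson :
    Module.finrank k (A ⧸ Ring.jacobson A) = sqDim k A := by
  have := Fintype.ofFinite (Irr k A)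
  obtain ⟨e⟩ := nonempty_quotient_jacobson_equiv k A
  rw [(e.restrictScalars k).finrank_eq, Module.finrank_pi_fintype, sqDim,
    finsum_eq_sum_of_fintype]
  refine Finset.sum_congr rfl fun V _ => ?_
  rw [Module.finrank_pi_fintype]
  simp [sq]

variable {k A}

/-- A finite-dimensional module in whose head every irreducible `X` has multiplicity at most
`r dim X` is generated by `r` elements: its head is then a quotient of `(A/Jac(A))^r`. -/
theorem exists_span_range_eq_top (M : Type w) [AddCommGroup M] [Module k M] [Module A M]
    [IsScalarTower k A M] [Module.Finite k M] (r : ℕ)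
    (hr : ∀ X : Irr k A, Module.finrank k (M →ₗ[A] X.rep) ≤ r * Module.finrank k X.rep) :
    ∃ e : Fin r → M, Submodule.span A (Set.range e) = ⊤ := by
  classical
  have := IsArtinianRing.of_finite k A
  have : Module.Finite A M := .of_restrictScalars_finite k A M
  let N : Submodule A M := Ring.jacobson A • ⊤
  have hss : IsSemisimpleModule A (M ⧸ N) :=
    isSemisimpleModule_of_jacobson_smul (k := k) fun a ha x => by
      obtain ⟨y, rfl⟩ := N.mkQ_surjective x
      rw [← map_smul]
      exact (Submodule.Quotient.mk_eq_zero _).2 (Submodule.smul_mem_smul ha trivial)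
  obtain ⟨eQ⟩ := IsSemisimpleModule.nonempty_linearEquiv_isotypic (k := k) (A := A) (M ⧸ N)
  obtain ⟨eA⟩ := nonempty_quotient_jacobson_equiv k A
  have hle : ∀ V : Irr k A, Module.finrank k (V.rep →ₗ[A] (M ⧸ N)) ≤
      r * Module.finrank k V.rep := by
    intro V
    rw [finrank_hom_rep_comm (k := k) (A := A) (M ⧸ N)]
    refine le_trans ?_ (hr V)
    have := Module.Finite.linearMap_restrict (k := k) (A := A) (M := M) (N := V.rep)
    exact LinearMap.finrank_le_finrank_of_injective (f := N.mkQ.lcomp k V.rep)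
      fun f g h => LinearMap.ext fun x => by
        obtain ⟨y, rfl⟩ := N.mkQ_surjective x
        exact LinearMap.congr_fun h y
  let j (V : Irr k A) : Fin (Module.finrank k (V.rep →ₗ[A] (M ⧸ N))) ↪
      Fin r × Fin (Module.finrank k V.rep) :=
    (Fin.castLEEmb (hle V)).trans finProdFinEquiv.symm.toEmbedding
  let g : (Fin r → ∀ V : Irr k A, Fin (Module.finrank k V.rep) → V.rep) →ₗ[A]
      ∀ V : Irr k A, Fin (Module.finrank k (V.rep →ₗ[A] (M ⧸ N))) → V.rep :=
    { toFun := fun y V i => y (j V i).1 V (j V i).2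
      map_add' := fun _ _ => rfl
      map_smul' := fun _ _ => rfl }
  have hg : Function.Surjective g := fun z => by
    refine ⟨fun a V b => Function.extend (j V) (z V) 0 (a, b), ?_⟩
    ext V i
    exact (j V).injective.extend_apply (z V) 0 i
  let c : (Fin r → A) →ₗ[A] (Fin r → ∀ V : Irr k A, Fin (Module.finrank k V.rep) → V.rep) :=
    LinearMap.pi fun i => eA.toLinearMap ∘ₗ Submodule.mkQ _ ∘ₗ LinearMap.proj i
  have hc : Function.Surjective c := fun y => by
    choose x hx using fun i => (Ring.jacobson A).mkQ_surjective (eA.symm (y i))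
    refine ⟨x, funext fun i => ?_⟩
    change eA ((Ring.jacobson A).mkQ (x i)) = y i
    rw [hx, LinearEquiv.apply_symm_apply]
  let q : (Fin r → A) →ₗ[A] (M ⧸ N) := eQ.symm.toLinearMap ∘ₗ g ∘ₗ c
  have hq : Function.Surjective q := eQ.symm.surjective.comp (hg.comp hc)
  obtain ⟨f, hf⟩ := Module.projective_lifting_property N.mkQ q N.mkQ_surjective
  -- By Nakayama's lemma the lift is surjective.
  have hsup : LinearMap.range f ⊔ N = ⊤ := by
    rw [eq_top_iff]
    intro x _
    obtain ⟨y, hy⟩ := hq (N.mkQ x)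
    have h0 : x - f y ∈ N := by
      rw [← Submodule.Quotient.mk_eq_zero, Submodule.Quotient.mk_sub, sub_eq_zero]
      exact hy.symm.trans (LinearMap.congr_fun hf y).symm
    have h1 : x = f y + (x - f y) := by abel
    rw [h1]
    exact Submodule.add_mem_sup ⟨y, rfl⟩ h0
  have htop : LinearMap.range f = ⊤ := by
    by_contra hne
    obtain ⟨P, hP, hle⟩ := (eq_top_or_exists_le_coatom (LinearMap.range f)).resolve_left hne
    refine hP.1 (eq_top_iff.2 (hsup ▸ sup_le hle ?_))
    have : IsSimpleModule A (M ⧸ P) := isSimpleModule_iff_isCoatom.2 hP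
    refine Submodule.smul_le.2 fun a ha x _ => ?_
    rw [← Submodule.Quotient.mk_eq_zero, Submodule.Quotient.mk_smul]
    exact jacobson_smul_of_isSemisimpleModule ha _
  refine ⟨fun i => f (Pi.single i 1), ?_⟩
  rw [eq_top_iff, ← htop]
  rintro _ ⟨y, rfl⟩
  rw [pi_eq_sum_univ' y, map_sum]
  refine Submodule.sum_mem _ fun i _ => ?_
  rw [map_smul]
  refine Submodule.smul_mem _ _ (Submodule.subset_span ⟨i, ?_⟩)
  congr 1

/-- If `I` annihilates all irreducible modules and each of these is a direct summand of a power of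
`A/I`, then `A/I` is semisimple: the projection `A/I → A/Jac(A)` splits. -/
theorem jacobson_le_of_retract (I : Ideal A) [I.IsTwoSided] (r : Irr k A → ℕ)
    (i : ∀ X : Irr k A, X.rep →ₗ[A] (Fin (r X) → A ⧸ I))
    (p : ∀ X : Irr k A, (Fin (r X) → A ⧸ I) →ₗ[A] X.rep)
    (hp : ∀ X x, p X (i X x) = x) (hI : I ≤ Ring.jacobson A) : Ring.jacobson A ≤ I := by
  classical
  obtain ⟨e⟩ := nonempty_quotient_jacobson_equiv k A
  have := Fintype.ofFinite (Irr k A)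
  let π : (A ⧸ I) →ₗ[A] (A ⧸ Ring.jacobson A) := Submodule.factor hI
  have hπ : Function.Surjective π := Submodule.factor_surjective hI
  -- Each irreducible module has the lifting property with respect to `π`.
  have lift : ∀ (X : Irr k A) (f : X.rep →ₗ[A] (A ⧸ Ring.jacobson A)),
      ∃ g : X.rep →ₗ[A] (A ⧸ I), π ∘ₗ g = f := by
    intro X f
    choose y hy using fun j => hπ (f (p X (Pi.single j 1)))
    let s (j : Fin (r X)) : (A ⧸ I) →ₗ[A] (A ⧸ I) := Submodule.liftQ I
      (LinearMap.toSpanSingleton A _ (y j)) fun a ha => by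
        obtain ⟨b, hb⟩ := Ideal.Quotient.mk_surjective (y j)
        rw [LinearMap.mem_ker, LinearMap.toSpanSingleton_apply, ← hb]
        exact Ideal.Quotient.eq_zero_iff_mem.2 (Ideal.mul_mem_right b _ ha)
    have hs : π ∘ₗ LinearMap.lsum A _ ℕ s = f ∘ₗ p X := by
      refine LinearMap.pi_ext' fun j => Submodule.linearMap_qext _ (LinearMap.ext_ring ?_)
      have : s j (Submodule.Quotient.mk 1) = y j := by
        change Submodule.liftQ I _ _ (Submodule.Quotient.mk 1) = y j
        rw [Submodule.liftQ_apply, LinearMap.toSpanSingleton_apply, one_smul]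
      simp only [LinearMap.comp_apply, LinearMap.coe_single, LinearMap.lsum_apply,
        LinearMap.sum_apply, LinearMap.proj_apply, Submodule.mkQ_apply, map_sum]
      rw [Finset.sum_eq_single j]
      · rw [Pi.single_eq_same, this, hy]
        rfl
      · intro b _ hb
        rw [Pi.single_eq_of_ne hb, map_zero, map_zero]
      · simp
    refine ⟨LinearMap.lsum A _ ℕ s ∘ₗ i X, ?_⟩
    rw [← LinearMap.comp_assoc, hs]
    ext x
    simp [hp]
  choose l hl using lift
  -- Lifting the summands of `A/Jac(A)` gives a section of `π`.
  let m (X : Irr k A) (j : Fin (Module.finrank k X.rep)) : X.rep →ₗ[A] (A ⧸ Ring.jacobson A) :=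
    e.symm.toLinearMap ∘ₗ LinearMap.single A _ X ∘ₗ LinearMap.single A (fun _ => X.rep) j
  let σ : (A ⧸ Ring.jacobson A) →ₗ[A] (A ⧸ I) :=
    LinearMap.lsum A _ ℕ (fun X => LinearMap.lsum A (fun _ => X.rep) ℕ fun j => l X (m X j)) ∘ₗ
      e.toLinearMap
  have hσ : π ∘ₗ LinearMap.lsum A _ ℕ (fun X => LinearMap.lsum A (fun _ => X.rep) ℕ
      fun j => l X (m X j)) = e.symm.toLinearMap := by
    refine LinearMap.pi_ext' fun X => LinearMap.pi_ext' fun j => LinearMap.ext fun x => ?_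
    have h0 := LinearMap.congr_fun (hl X (m X j)) x
    simp only [LinearMap.comp_apply, LinearMap.coe_single, LinearMap.lsum_apply,
      LinearMap.sum_apply, LinearMap.proj_apply]
    rw [Finset.sum_eq_single X, Finset.sum_eq_single j]
    · rw [Pi.single_eq_same, Pi.single_eq_same]
      exact h0
    · intro b _ hb
      rw [Pi.single_eq_same, Pi.single_eq_of_ne hb, map_zero]
    · simp
    · intro b _ hb
      rw [Pi.single_eq_of_ne hb]
      simp
    · simp
  -- The section `σ` sends `1` to the class of a unit `x`, and `Jac(A) x` lies in `I`.
  obtain ⟨x, hx⟩ := Ideal.Quotient.mk_surjective (σ (Submodule.Quotient.mk 1))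
  have hx1 : 1 - x ∈ Ring.jacobson A := by
    have h1 : π (σ (Submodule.Quotient.mk 1)) = Submodule.Quotient.mk 1 := by
      have := LinearMap.congr_fun hσ (e (Submodule.Quotient.mk 1))
      simpa [σ] using this
    rw [← hx] at h1
    exact (Submodule.Quotient.eq _).1 h1.symm
  have hxu : IsUnit x := by
    have := IsArtinianRing.of_finite k A
    obtain ⟨n, hn⟩ : IsNilpotent (Ring.jacobson A) := IsSemiprimaryRing.isNilpotent
    have : IsNilpotent (1 - x) := ⟨n, by
      have := Ideal.pow_mem_pow hx1 n
      rwa [hn] at this⟩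
    simpa using this.isUnit_one_sub
  intro a ha
  have hax : a * x ∈ I := by
    rw [← Ideal.Quotient.eq_zero_iff_mem, map_mul, hx]
    change a • σ (Submodule.Quotient.mk 1) = 0
    rw [← map_smul, ← Submodule.Quotient.mk_smul]
    have : (Submodule.Quotient.mk (a • (1 : A)) : A ⧸ Ring.jacobson A) = 0 :=
      (Submodule.Quotient.mk_eq_zero _).2 (by simpa using ha)
    rw [this, map_zero]
  obtain ⟨y, rfl⟩ := hxu
  have := Ideal.mul_mem_right (↑y⁻¹ : A) I hax
  simpa [mul_assoc] using this

end FiniteDimensionalAlgebra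

/-! ### Families of modules free over a semisimple quotient -/

section Core

variable {k : Type u} {A : Type v} [Field k] [Ring A] [Algebra k A]

theorem finrank_fun_hom (t : ℕ) (M : Type*) (N : Type*) [AddCommGroup M] [Module k M] [Module A M]
    [IsScalarTower k A M] [AddCommGroup N] [Module k N] [Module A N] [IsScalarTower k A N]
    [Module.Finite k M] [Module.Finite k N] :
    Module.finrank k ((Fin t → M) →ₗ[A] N) = t * Module.finrank k (M →ₗ[A] N) := by
  have := Module.Finite.linearMap_restrict (k := k) (A := A) (M := M) (N := N)
  rw [← (LinearMap.lsum A (fun _ : Fin t => M) k).finrank_eq, Module.finrank_pi_fintype]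
  simp

/-- If `M` is generated by `r` elements and there are at least `r dim N` homomorphisms from `M`
to `N`, then these generators are free modulo the annihilator of `N`. -/
theorem nonempty_linearEquiv_of_finrank_hom_le {M : Type*} {N : Type*} [AddCommGroup M]
    [Module k M] [Module A M] [IsScalarTower k A M] [AddCommGroup N] [Module k N] [Module A N]
    [IsScalarTower k A N] [Module.Finite k M] [Module.Finite k N] (I : Ideal A) [I.IsTwoSided]
    (hM : ∀ a ∈ I, ∀ x : M, a • x = 0) (hN : ∀ a : A, (∀ x : N, a • x = 0) → a ∈ I) {r : ℕ}
    (e : Fin r → M) (he : Submodule.span A (Set.range e) = ⊤)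
    (hr : r * Module.finrank k N ≤ Module.finrank k (M →ₗ[A] N)) :
    Nonempty ((Fin r → A ⧸ I) ≃ₗ[A] M) := by
  classical
  have := Module.Finite.linearMap_restrict (k := k) (A := A) (M := M) (N := N)
  let E : (M →ₗ[A] N) →ₗ[k] (Fin r → N) :=
    { toFun := fun f i => f (e i)
      map_add' := fun _ _ => rfl
      map_smul' := fun _ _ => rfl }
  have hE : Function.Injective E := fun f g h =>
    LinearMap.ext_on he (by rintro _ ⟨i, rfl⟩; exact congrFun h i)
  have hE' : Function.Surjective E := by
    refine (LinearMap.injective_iff_surjective_of_finrank_eq_finrank (le_antisymm ?_ ?_)).1 hE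
    · exact LinearMap.finrank_le_finrank_of_injective hE
    · simpa [Module.finrank_pi_fintype] using hr
  -- As the values on the generators can be prescribed, the coefficients of a relation
  -- annihilate `N`.
  have hrel : ∀ c : Fin r → A, ∑ i, c i • e i = 0 → ∀ i, c i ∈ I := by
    intro c hc i
    refine hN _ fun x => ?_
    obtain ⟨f, hf⟩ := hE' (Pi.single i x)
    have hf' : ∀ j, f (e j) = Pi.single (M := fun _ => N) i x j := congrFun hf
    have := congrArg f hc
    rw [map_sum, map_zero, Finset.sum_eq_single i] at this
    · rwa [map_smul, hf', Pi.single_eq_same] at this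
    · intro j _ hj
      rw [map_smul, hf', Pi.single_eq_of_ne hj, smul_zero]
    · simp
  let s (i : Fin r) : (A ⧸ I) →ₗ[A] M := Submodule.liftQ I (LinearMap.toSpanSingleton A M (e i))
    fun a ha => by simpa using hM a ha (e i)
  let φ : (Fin r → A ⧸ I) →ₗ[A] M := LinearMap.lsum A _ ℕ s
  have hφ : ∀ c : Fin r → A, φ (fun i => Submodule.Quotient.mk (c i)) = ∑ i, c i • e i := by
    intro c
    simp only [φ, LinearMap.lsum_apply, LinearMap.sum_apply, LinearMap.comp_apply,
      LinearMap.proj_apply]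
    rfl
  refine ⟨LinearEquiv.ofBijective φ ⟨?_, ?_⟩⟩
  · rw [injective_iff_map_eq_zero]
    intro y hy
    choose c hc using fun i => I.mkQ_surjective (y i)
    obtain rfl : (fun i => I.mkQ (c i)) = y := funext hc
    funext i
    exact (Submodule.Quotient.mk_eq_zero I).2 (hrel c ((hφ c).symm.trans hy) i)
  · rw [← LinearMap.range_eq_top, eq_top_iff, ← he, Submodule.span_le]
    rintro _ ⟨i, rfl⟩
    refine ⟨fun j => Submodule.Quotient.mk (Pi.single (M := fun _ => A) i 1 j), ?_⟩
    rw [hφ, Finset.sum_eq_single i]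
    · simp
    · intro j _ hj
      simp [hj]
    · simp

variable [IsAlgClosed k] [Module.Finite k A]

theorem mem_jacobson_of_forall_smul_rep {a : A} (h : ∀ (X : Irr k A) (x : X.rep), a • x = 0) :
    a ∈ Ring.jacobson A := by
  obtain ⟨e⟩ := nonempty_quotient_jacobson_equiv k A
  have h1 : a • (Submodule.Quotient.mk 1 : A ⧸ Ring.jacobson A) = 0 := by
    apply e.injective
    rw [map_smul, map_zero]
    funext V j
    exact h V _
  rw [← Submodule.Quotient.mk_smul, Submodule.Quotient.mk_eq_zero] at h1
  simpa using h1

/-- Let `T` assign to every irreducible module `W` a module `T W` of dimension `d dim W` which has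
`W` as a direct summand and at least `d dim Hom(T W, U)` independent homomorphisms to `T U`, and
suppose that all `T W` have the same annihilator. Then some power of each `T W` is free over
`A/Jac(A)`, which determines the multiplicity of `U` in `T W`. -/
theorem finrank_hom_mul_sqDim (d : ℕ) (T : Irr k A → AlgModule.{u, v, v} k A)
    [∀ W, Module.Finite k (T W)]
    (hdim : ∀ W, Module.finrank k (T W) = d * Module.finrank k W.rep)
    (hT : ∀ W U, d * Module.finrank k (T W →ₗ[A] U.rep) ≤ Module.finrank k (T W →ₗ[A] T U))
    (i : ∀ W : Irr k A, W.rep →ₗ[A] T W) (p : ∀ W : Irr k A, T W →ₗ[A] W.rep)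
    (hp : ∀ W x, p W (i W x) = x)
    (hann : ∀ U W, ∀ a : A, (∀ x : T U, a • x = 0) → ∀ x : T W, a • x = 0) (W U : Irr k A) :
    Module.finrank k (T W →ₗ[A] U.rep) * sqDim k A =
      d * (Module.finrank k W.rep * Module.finrank k U.rep) := by
  classical
  let I : Ideal A := Module.annihilator A (T W)
  have hI : ∀ (X : Irr k A) (a : A), a ∈ I ↔ ∀ x : T X, a • x = 0 := fun X a =>
    ⟨fun h => hann W X a (Module.mem_annihilator.1 h),
      fun h => Module.mem_annihilator.2 (hann X W a h)⟩
  -- The quotient `Y` of largest multiplicity relative to its dimension bounds the number of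
  -- generators of a power of `T X`; the exponent makes this bound an integer.
  have hfree : ∀ X : Irr k A, ∃ Y : Irr k A,
      Nonempty ((Fin (Module.finrank k (T X →ₗ[A] Y.rep)) → A ⧸ I) ≃ₗ[A]
        (Fin (Module.finrank k Y.rep) → T X)) := by
    intro X
    have : Nonempty (Irr k A) := ⟨X⟩
    obtain ⟨Y, hY⟩ := Finite.exists_max fun Y : Irr k A =>
      (Module.finrank k (T X →ₗ[A] Y.rep) : ℚ) / Module.finrank k Y.rep
    refine ⟨Y, ?_⟩
    obtain ⟨e, he⟩ := exists_span_range_eq_top (k := k) (A := A)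
      (Fin (Module.finrank k Y.rep) → T X) (Module.finrank k (T X →ₗ[A] Y.rep)) fun Z => by
        rw [finrank_fun_hom, mul_comm]
        have h := hY Z
        have h1 : (0 : ℚ) < Module.finrank k Z.rep := by exact_mod_cast Z.finrank_rep_pos
        have h2 : (0 : ℚ) < Module.finrank k Y.rep := by exact_mod_cast Y.finrank_rep_pos
        rw [div_le_div_iff₀ h1 h2] at h
        exact_mod_cast h
    have hM : ∀ a ∈ I, ∀ x : Fin (Module.finrank k Y.rep) → T X, a • x = 0 :=
      fun a ha x => funext fun j => (hI X a).1 ha (x j)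
    refine nonempty_linearEquiv_of_finrank_hom_le (k := k) (N := T Y) I hM
      (fun a ha => (hI Y a).2 ha) e he ?_
    rw [finrank_fun_hom, hdim]
    calc _ = Module.finrank k Y.rep * (d * Module.finrank k (T X →ₗ[A] Y.rep)) := by ring
      _ ≤ _ := Nat.mul_le_mul_left _ (hT X Y)
  choose Y E using hfree
  have hIJ : I ≤ Ring.jacobson A := fun a ha => mem_jacobson_of_forall_smul_rep fun X x => by
    rw [← hp X x, ← map_smul, (hI X a).1 ha, map_zero]
  have hJI : Ring.jacobson A = I := by
    refine le_antisymm (jacobson_le_of_retract I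
      (fun X => Module.finrank k (T X →ₗ[A] (Y X).rep))
      (fun X => (E X).some.symm.toLinearMap ∘ₗ LinearMap.pi fun _ => i X)
      (fun X => p X ∘ₗ LinearMap.proj (⟨0, (Y X).finrank_rep_pos⟩ : Fin _) ∘ₗ
        (E X).some.toLinearMap) (fun X x => ?_) hIJ) hIJ
    simp [hp]
  obtain ⟨e⟩ := E W
  have h1 := finrank_hom_congr_left (k := k) e U.rep
  have h2 := (e.restrictScalars k).finrank_eq
  have hIU := finrank_quotient_hom (k := k) I U.rep fun a ha x => by
    rw [← hp U x, ← map_smul, (hI U a).1 ha, map_zero]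
  rw [finrank_fun_hom, finrank_fun_hom, hIU] at h1
  have hS : Module.finrank k (A ⧸ I) = sqDim k A := by
    rw [← finrank_quotient_jacobson k A, hJI]
  rw [Module.finrank_pi_fintype, Module.finrank_pi_fintype] at h2
  simp only [Finset.sum_const, Finset.card_univ, Fintype.card_fin, smul_eq_mul, hS, hdim] at h2
  apply Nat.eq_of_mul_eq_mul_left (Y W).finrank_rep_pos
  rw [← mul_assoc, ← h1]
  calc _ = (Module.finrank k (T W →ₗ[A] (Y W).rep) * sqDim k A) * Module.finrank k U.rep := by ring
    _ = _ := by rw [h2]; ring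

end Core

/-! ### Tensor products and spaces of linear maps over a Hopf algebra -/

namespace AlgModule

section Bialgebra

variable {k : Type u} {H : Type v} [Field k] [Ring H]

/-- The orbit map `a ↦ a • x`. -/
def orbit [Algebra k H] (M : AlgModule.{u, v, w} k H) (x : M) : H →ₗ[k] M :=
  (LinearMap.toSpanSingleton H M x).restrictScalars k

@[simp]
theorem orbit_apply [Algebra k H] (M : AlgModule.{u, v, w} k H) (x : M) (a : H) :
    M.orbit x a = a • x := rfl

variable [Bialgebra k H] (V : AlgModule.{u, v, w} k H) (W : AlgModule.{u, v, w'} k H)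

/-- The bilinear map `V × W → V ⊗ W`. -/
noncomputable def tmul : V →ₗ[k] W →ₗ[k] V.tensor W := TensorProduct.mk k V W

variable {V W}

theorem tensor_induction {motive : V.tensor W → Prop} (x : V.tensor W) (zero : motive 0)
    (tmul : ∀ v w, motive (tmul V W v w)) (add : ∀ x y, motive x → motive y → motive (x + y)) :
    motive x :=
  TensorProduct.induction_on (motive := motive) x zero tmul add

/-- A `k`-bilinear map on `V × W` as a `k`-linear map on `V ⊗ W`. -/
noncomputable def tensorLift {P : Type*} [AddCommGroup P] [Module k P] (f : V →ₗ[k] W →ₗ[k] P) :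
    V.tensor W →ₗ[k] P := TensorProduct.lift (R := k) (M := V) (N := W) f

@[simp]
theorem tensorLift_tmul {P : Type*} [AddCommGroup P] [Module k P] (f : V →ₗ[k] W →ₗ[k] P) (v : V)
    (w : W) : tensorLift f (tmul V W v w) = f v w := rfl

theorem smul_tmul_eq_map (h : H) (v : V) (w : W) :
    h • tmul V W v w =
      TensorProduct.map (V.orbit v) (W.orbit w) (Coalgebra.comul (R := k) h) := by
  have key : ∀ t : H ⊗[k] H, (Module.endTensorEndAlgHom (R := k) (A := k) (M := V) (N := W) (S := k)
      (Algebra.TensorProduct.map (Algebra.lsmul k k V) (Algebra.lsmul k k W) t)) (v ⊗ₜ[k] w) =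
      TensorProduct.map (V.orbit v) (W.orbit w) t := by
    intro t
    induction t with
    | zero => simp
    | add a b ha hb => simp only [map_add, LinearMap.add_apply, ha, hb]
    | tmul a b => rfl
  exact key _

theorem smul_tmul {ι : Type*} (h : H) (r : Coalgebra.Repr k h ι) (v : V) (w : W) :
    h • tmul V W v w = ∑ i ∈ r.index, tmul V W (r.left i • v) (r.right i • w) := by
  rw [smul_tmul_eq_map, ← r.eq, map_sum]
  rfl

/-- A `k`-linear map on a tensor product which is `H`-equivariant on pure tensors. -/
noncomputable def tensorHom {M : AlgModule.{u, v, w} k H} (f : V.tensor W →ₗ[k] M)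
    (hf : ∀ (h : H) (v : V) (w : W), f (h • tmul V W v w) = h • f (tmul V W v w)) :
    V.tensor W →ₗ[H] M :=
  { f with
    map_smul' := fun h x => by
      change f (h • x) = h • f x
      induction x using tensor_induction with
      | zero => simp
      | tmul v w => exact hf h v w
      | add x y hx hy => rw [smul_add, map_add, map_add, hx, hy, smul_add] }

/-- If the image of `Δ(h)` in `H/J ⊗ H/J` vanishes, then `h` annihilates the tensor product of any
two vectors annihilated by `J`. -/
theorem smul_tmul_eq_zero {J : Ideal H} {h : H}
    (hJ : TensorProduct.map (J.restrictScalars k).mkQ (J.restrictScalars k).mkQ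
      (Coalgebra.comul (R := k) h) = 0) {v : V} {w : W}
    (hv : ∀ a ∈ J, a • v = 0) (hw : ∀ a ∈ J, a • w = 0) : h • tmul V W v w = 0 := by
  have h1 : V.orbit v = (J.restrictScalars k).liftQ (V.orbit v) hv ∘ₗ
    (J.restrictScalars k).mkQ := rfl
  have h2 : W.orbit w = (J.restrictScalars k).liftQ (W.orbit w) hw ∘ₗ
    (J.restrictScalars k).mkQ := rfl
  rw [smul_tmul_eq_map, h1, h2, TensorProduct.map_comp, LinearMap.comp_apply, hJ, map_zero]
  rfl

instance finite_tensor [Module.Finite k V] [Module.Finite k W] : Module.Finite k (V.tensor W) :=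
  inferInstanceAs (Module.Finite k (V ⊗[k] W))

theorem finrank_tensor : Module.finrank k (V.tensor W) =
    Module.finrank k V * Module.finrank k W :=
  Module.finrank_tensorProduct (R := k) (S := k) (M := V) (M' := W)

end Bialgebra

section Hopf

variable {k : Type u} {H : Type v} [Field k] [Ring H] [HopfAlgebra k H]

/-- The action `(a ⊗ b) φ = a ∘ φ ∘ S(b)` of `H ⊗ H` on linear maps. -/
noncomputable def homAction (X : AlgModule.{u, v, w} k H) (Y : AlgModule.{u, v, w'} k H) :
    H ⊗[k] H →ₐ[k] Module.End k (X →ₗ[k] Y) :=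
  Algebra.TensorProduct.lift
    (AlgHom.ofLinearMap (LinearMap.llcomp k X Y Y ∘ₗ (Algebra.lsmul k k Y).toLinearMap)
      (by ext; simp) (fun a b => by ext; simp))
    (AlgHom.ofLinearMap ((LinearMap.llcomp k X X Y).flip ∘ₗ (Algebra.lsmul k k X).toLinearMap ∘ₗ
        HopfAlgebra.antipode k)
      (by ext; simp) (fun a b => by ext; simp [HopfAlgebra.antipode_mul_antidistrib]))
    (fun a b => by ext; rfl)

/-- The space of linear maps `X → Y` with the action `(h φ)(x) = ∑ h₁ φ(S(h₂) x)`. -/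
noncomputable def homMod (X : AlgModule.{u, v, w} k H) (Y : AlgModule.{u, v, w'} k H) :
    AlgModule.{u, v, max w w'} k H :=
  ofAlgHom ((homAction X Y).comp (Bialgebra.comulAlgHom k H))

variable {V : AlgModule.{u, v, w} k H} {X : AlgModule.{u, v, w} k H} {Y : AlgModule.{u, v, w} k H}

/-- A linear map, as an element of the module of linear maps. -/
def homMod.of : (X →ₗ[k] Y) ≃ₗ[k] X.homMod Y := LinearEquiv.refl k (X →ₗ[k] Y)

theorem homMod.smul_apply {ι : Type*} (h : H) (r : Coalgebra.Repr k h ι) (φ : X.homMod Y) (x : X) :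
    homMod.of.symm (h • φ) x = ∑ i ∈ r.index, r.left i • homMod.of.symm φ
      (HopfAlgebra.antipode k (r.right i) • x) := by
  change homAction X Y (Coalgebra.comul (R := k) h) (homMod.of.symm φ) x = _
  rw [← r.eq, map_sum, LinearMap.sum_apply, LinearMap.sum_apply]
  rfl

open Coalgebra HopfAlgebra

/-- Currying is equivariant: `∑ h₁ F(v ⊗ S(h₂) x) = F(h v ⊗ x)`. -/
theorem curry_smul (F : V.tensor X →ₗ[H] Y) (h : H) (v : V) (x : X) {ι : Type*}
    (r : Repr k h ι) :
    ∑ i ∈ r.index, r.left i • F (tmul V X v (antipode k (r.right i) • x)) =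
      F (tmul V X (h • v) x) := by
  let Θ : H ⊗[k] (H ⊗[k] H) →ₗ[k] Y := (F.restrictScalars k) ∘ₗ
    TensorProduct.map (V.orbit v) (X.orbit x ∘ₗ LinearMap.mul' k H ∘ₗ (antipode k).lTensor H)
  have hΘ : ∀ a b c, Θ (a ⊗ₜ (b ⊗ₜ c)) = F (tmul V X (a • v) ((b * antipode k c) • x)) :=
    fun _ _ _ => rfl
  have key := congrArg Θ (sum_tmul_tmul_eq r (fun i => ℛ k (r.left i)) (fun i => ℛ k (r.right i)))
  simp only [map_sum, hΘ] at key
  calc _ = ∑ i ∈ r.index, ∑ j ∈ (ℛ k (r.left i)).index, F (tmul V X ((ℛ k (r.left i)).left j • v)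
        (((ℛ k (r.left i)).right j * antipode k (r.right i)) • x)) := by
        refine Finset.sum_congr rfl fun i _ => ?_
        rw [← map_smul, smul_tmul _ (ℛ k (r.left i)), map_sum]
        simp only [mul_smul]
    _ = ∑ i ∈ r.index, F (tmul V X (r.left i • v) (counit (R := k) (r.right i) • x)) := by
        rw [key]
        refine Finset.sum_congr rfl fun i _ => ?_
        rw [← map_sum, ← map_sum, ← Finset.sum_smul, sum_mul_antipode_eq_smul, smul_assoc,
          one_smul]
    _ = F (tmul V X ((∑ i ∈ r.index, counit (R := k) (r.right i) • r.left i) • v) x) := by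
        rw [Finset.sum_smul, map_sum, LinearMap.sum_apply, map_sum]
        refine Finset.sum_congr rfl fun i _ => ?_
        rw [smul_assoc, LinearMap.map_smul (tmul V X (r.left i • v)), LinearMap.map_smul (tmul V X),
          LinearMap.smul_apply]
    _ = _ := by
        have := congrArg (TensorProduct.lift (LinearMap.lsmul k H).flip) (sum_tmul_counit_eq r)
        simp only [map_sum, TensorProduct.lift.tmul, LinearMap.flip_apply, LinearMap.lsmul_apply,
          one_smul] at this
        rw [this]

/-- Uncurrying is equivariant: `∑ G(h₁ v)(h₂ x) = h G(v)(x)`. -/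
theorem uncurry_smul (G : V →ₗ[H] X.homMod Y) (h : H) (v : V) (x : X) {ι : Type*}
    (r : Repr k h ι) :
    ∑ i ∈ r.index, homMod.of.symm (G (r.left i • v)) (r.right i • x) =
      h • homMod.of.symm (G v) x := by
  let Θ : H ⊗[k] (H ⊗[k] H) →ₗ[k] Y := TensorProduct.lift (Algebra.lsmul k k Y).toLinearMap ∘ₗ
    ((homMod.of.symm (G v)) ∘ₗ X.orbit x ∘ₗ LinearMap.mul' k H ∘ₗ
      (antipode k).rTensor H).lTensor H
  have hΘ : ∀ a b c, Θ (a ⊗ₜ (b ⊗ₜ c)) =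
      a • homMod.of.symm (G v) ((antipode k b * c) • x) := fun _ _ _ => rfl
  have key := congrArg Θ (sum_tmul_tmul_eq r (fun i => ℛ k (r.left i)) (fun i => ℛ k (r.right i)))
  simp only [map_sum, hΘ] at key
  calc _ = ∑ i ∈ r.index, ∑ j ∈ (ℛ k (r.left i)).index, (ℛ k (r.left i)).left j •
        homMod.of.symm (G v) ((antipode k ((ℛ k (r.left i)).right j) * r.right i) • x) := by
        refine Finset.sum_congr rfl fun i _ => ?_
        rw [G.map_smul, homMod.smul_apply _ (ℛ k (r.left i))]
        simp only [mul_smul]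
    _ = ∑ i ∈ r.index, r.left i • homMod.of.symm (G v) (counit (R := k) (r.right i) • x) := by
        rw [key]
        refine Finset.sum_congr rfl fun i _ => ?_
        rw [← Finset.smul_sum, ← map_sum, ← Finset.sum_smul, sum_antipode_mul_eq_smul, smul_assoc,
          one_smul]
    _ = (∑ i ∈ r.index, counit (R := k) (r.right i) • r.left i) • homMod.of.symm (G v) x := by
        rw [Finset.sum_smul]
        refine Finset.sum_congr rfl fun i _ => ?_
        rw [map_smul, smul_comm, smul_assoc]
    _ = _ := by
        have := congrArg (TensorProduct.lift (LinearMap.lsmul k H).flip) (sum_tmul_counit_eq r)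
        simp only [map_sum, TensorProduct.lift.tmul, LinearMap.flip_apply, LinearMap.lsmul_apply,
          one_smul] at this
        rw [this]

/-- The adjunction `Hom_H(V ⊗ X, Y) ≃ Hom_H(V, Hom_k(X, Y))`. -/
noncomputable def curryEquiv (V : AlgModule.{u, v, w} k H) (X : AlgModule.{u, v, w} k H)
    (Y : AlgModule.{u, v, w} k H) : (V.tensor X →ₗ[H] Y) ≃ₗ[k] (V →ₗ[H] X.homMod Y) where
  toFun F :=
    { toFun := fun v => homMod.of ((F.restrictScalars k) ∘ₗ tmul V X v)
      map_add' := fun v v' => by rw [map_add, LinearMap.comp_add, map_add]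
      map_smul' := fun h v => by
        apply homMod.of.symm.injective
        ext x
        rw [RingHom.id_apply, homMod.smul_apply h (ℛ k h)]
        exact (curry_smul F h v x (ℛ k h)).symm }
  invFun G := tensorHom (tensorLift (homMod.of.symm.toLinearMap ∘ₗ G.restrictScalars k))
    fun h v x => by
      rw [smul_tmul h (ℛ k h), map_sum]
      exact uncurry_smul G h v x (ℛ k h)
  map_add' F G := rfl
  map_smul' r F := rfl
  left_inv F := by
    ext x
    induction x using tensor_induction with
    | zero => simp only [map_zero]
    | tmul v w => rfl
    | add x y hx hy => rw [map_add, map_add, hx, hy]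
  right_inv G := rfl

theorem curryEquiv_apply (F : V.tensor X →ₗ[H] Y) (v : V) (x : X) :
    homMod.of.symm (curryEquiv V X Y F v) x = F (tmul V X v x) := rfl

theorem curryEquiv_symm_apply (G : V →ₗ[H] X.homMod Y) (v : V) (x : X) :
    (curryEquiv V X Y).symm G (tmul V X v x) = homMod.of.symm (G v) x := rfl

/-- The natural map `V ⊗ Hom_k(X, Y) → Hom_k(X, V ⊗ Y)`. -/
noncomputable def tensorHomMod (V : AlgModule.{u, v, w} k H) (X : AlgModule.{u, v, w} k H)
    (Y : AlgModule.{u, v, w} k H) : V.tensor (X.homMod Y) →ₗ[H] X.homMod (V.tensor Y) :=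
  tensorHom (tensorLift ((LinearMap.llcomp k X Y (V.tensor Y)) ∘ₗ tmul V Y)) fun h v φ => by
    let r := ℛ k h
    apply homMod.of.symm.injective
    ext x
    let Θ : H ⊗[k] (H ⊗[k] H) →ₗ[k] V.tensor Y := TensorProduct.map (V.orbit v)
      (TensorProduct.lift (Algebra.lsmul k k Y).toLinearMap ∘ₗ
        ((homMod.of.symm φ) ∘ₗ X.orbit x ∘ₗ antipode k).lTensor H)
    have hΘ : ∀ a b c, Θ (a ⊗ₜ (b ⊗ₜ c)) =
        tmul V Y (a • v) (b • homMod.of.symm φ (antipode k c • x)) := fun _ _ _ => rfl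
    have key := congrArg Θ
      (sum_tmul_tmul_eq r (fun i => ℛ k (r.left i)) (fun i => ℛ k (r.right i)))
    simp only [map_sum, hΘ] at key
    rw [smul_tmul h r, homMod.smul_apply h r, map_sum, map_sum, LinearMap.sum_apply]
    calc _ = ∑ i ∈ r.index, tmul V Y (r.left i • v) (homMod.of.symm (r.right i • φ) x) := rfl
      _ = _ := by
        simp only [fun i => homMod.smul_apply (r.right i) (ℛ k (r.right i)) φ x, map_sum]
        rw [← key]
        refine Finset.sum_congr rfl fun i _ => ?_
        exact (smul_tmul (r.left i) (ℛ k (r.left i)) v _).symm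

theorem tensorHomMod_apply (v : V) (φ : X.homMod Y) (x : X) :
    homMod.of.symm (tensorHomMod V X Y (tmul V _ v φ)) x = tmul V Y v (homMod.of.symm φ x) := rfl

theorem tensorHomMod_bijective [Module.Finite k X] :
    Function.Bijective (tensorHomMod V X Y) := by
  have h := (lTensorHomEquivHomLTensor k X V Y).bijective
  have h2 : (⇑(tensorHomMod V X Y) : V ⊗[k] (X →ₗ[k] Y) → (X →ₗ[k] V ⊗[k] Y)) =
      lTensorHomEquivHomLTensor k X V Y := by
    funext x
    exact (lTensorHomEquivHomLTensor_apply (R := k) (M := X) (P := V) (Q := Y) x).symm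
  rw [← h2] at h
  exact h

end Hopf

end AlgModule

/-! ### Modules over a quotient by an ideal which is a coideal -/

namespace AlgModule

variable {k : Type u} {H : Type v} [Field k] [Ring H]

/-- The cyclic `H`-module `H/J`. -/
def quot [Algebra k H] (J : Ideal H) : AlgModule.{u, v, v} k H where
  carrier := H ⧸ J

/-- The class of `a` in `H/J`. -/
def quotMk [Algebra k H] (J : Ideal H) (a : H) : quot (k := k) J :=
  (Submodule.Quotient.mk a : H ⧸ J)

/-- The vectors annihilated by `J`. -/
def invariants [Algebra k H] (J : Ideal H) (M : AlgModule.{u, v, w} k H) : Submodule k M where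
  carrier := {x | ∀ h ∈ J, h • x = 0}
  add_mem' hx hy h hh := by rw [smul_add, hx h hh, hy h hh, add_zero]
  zero_mem' h _ := smul_zero h
  smul_mem' r x hx h hh := by rw [smul_comm, hx h hh, smul_zero]

/-- Homomorphisms from `H/J` to `M` are the vectors of `M` annihilated by `J`. -/
def quotHomEquiv [Algebra k H] (J : Ideal H) (M : AlgModule.{u, v, w} k H) :
    (quot (k := k) J →ₗ[H] M) ≃ₗ[k] invariants J M where
  toFun f := ⟨f (quotMk J 1), fun h hh => by
    rw [← map_smul]
    have : h • quotMk (k := k) J 1 = 0 :=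
      (Submodule.Quotient.mk_eq_zero J).2 (by simpa using hh)
    rw [this, map_zero]⟩
  invFun x := Submodule.liftQ J (LinearMap.toSpanSingleton H M x) fun a ha => by
    simpa using x.2 a ha
  map_add' f g := rfl
  map_smul' r f := rfl
  left_inv f := Submodule.linearMap_qext J (LinearMap.ext_ring (one_smul H (f (quotMk J 1))))
  right_inv x := Subtype.ext (one_smul H (x : M))

theorem quotHomEquiv_symm_mk_one [Algebra k H] (J : Ideal H) (M : AlgModule.{u, v, w} k H)
    (x : invariants J M) : (quotHomEquiv J M).symm x (quotMk J 1) = x :=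
  one_smul H (x : M)

theorem smul_quot [Algebra k H] (J : Ideal H) [J.IsTwoSided] {h : H} (hh : h ∈ J)
    (x : quot (k := k) J) : h • x = 0 := by
  obtain ⟨a, rfl⟩ := J.mkQ_surjective x
  exact (Submodule.Quotient.mk_eq_zero J).2 (Ideal.mul_mem_right a J hh)

/-- A vector `t` of `H/J` with `h t = ε(h) t` and `ε(t) = 1` makes `W` a direct summand of
`H/J ⊗ W`. -/
theorem exists_retract_quot_tensor [Bialgebra k H] (J : Ideal H)
    (hε : ∀ h ∈ J, Coalgebra.counit (R := k) h = 0) {t : H}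
    (ht : ∀ h, h * t - Coalgebra.counit (R := k) h • t ∈ J) (ht1 : Coalgebra.counit (R := k) t = 1)
    (W : AlgModule.{u, v, v} k H) :
    ∃ (i : W →ₗ[H] (quot (k := k) J).tensor W) (p : (quot (k := k) J).tensor W →ₗ[H] W),
      ∀ x, p (i x) = x := by
  have hact : ∀ h : H, h • quotMk (k := k) J t = Coalgebra.counit (R := k) h • quotMk J t :=
    fun h => (Submodule.Quotient.eq J).2 (ht h)
  let ε : quot (k := k) J →ₗ[k] k :=
    (J.restrictScalars k).liftQ (Coalgebra.counit (R := k) (A := H)) hε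
  have hεmk : ∀ a, ε (quotMk J a) = Coalgebra.counit (R := k) a := fun a => rfl
  have hε' : ∀ (h : H) (b : quot (k := k) J), ε (h • b) = Coalgebra.counit (R := k) h * ε b := by
    intro h b
    obtain ⟨a, rfl⟩ := J.mkQ_surjective b
    exact Bialgebra.counit_mul h a
  refine ⟨{ tmul (quot J) W (quotMk J t) with
    map_smul' := fun h x => ?_ }, tensorHom (tensorLift ((LinearMap.lsmul k W) ∘ₗ ε))
      fun h b x => ?_, fun x => ?_⟩
  · change tmul (quot J) W (quotMk J t) (h • x) = h • tmul (quot J) W (quotMk J t) x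
    let r := Coalgebra.Repr.arbitrary k h
    rw [smul_tmul h r]
    conv_lhs => rw [← Coalgebra.sum_counit_smul r, Finset.sum_smul, map_sum]
    refine Finset.sum_congr rfl fun i _ => ?_
    rw [hact, LinearMap.map_smul (tmul (quot J) W), LinearMap.smul_apply, smul_assoc,
      LinearMap.map_smul]
  · let r := Coalgebra.Repr.arbitrary k h
    rw [smul_tmul h r, map_sum]
    conv_rhs => rw [← Coalgebra.sum_counit_smul r, Finset.sum_smul]
    refine Finset.sum_congr rfl fun i _ => ?_
    simp only [tensorLift_tmul, LinearMap.comp_apply, LinearMap.lsmul_apply, hε']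
    rw [mul_smul, smul_assoc, smul_comm (r.right i)]
  · change ε (quotMk J t) • x = x
    rw [hεmk, ht1, one_smul]

variable [HopfAlgebra k H] (J : Ideal H)

theorem finrank_quot_tensor_hom (X Y : AlgModule.{u, v, v} k H) :
    Module.finrank k ((quot (k := k) J).tensor X →ₗ[H] Y) =
      Module.finrank k (invariants J (X.homMod Y)) :=
  ((curryEquiv (quot J) X Y).trans (quotHomEquiv J _)).finrank_eq

instance finite_homMod (X Y : AlgModule.{u, v, v} k H) [Module.Finite k X] [Module.Finite k Y] :
    Module.Finite k (X.homMod Y) :=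
  inferInstanceAs (Module.Finite k (X →ₗ[k] Y))

theorem finrank_homMod (X Y : AlgModule.{u, v, v} k H) [Module.Finite k X] [Module.Finite k Y] :
    Module.finrank k (X.homMod Y) = Module.finrank k X * Module.finrank k Y :=
  Module.finrank_linearMap k k X Y

theorem finrank_quot_tensor_hom_le (X Y : AlgModule.{u, v, v} k H) [Module.Finite k X]
    [Module.Finite k Y] :
    Module.finrank k ((quot (k := k) J).tensor X →ₗ[H] Y) ≤
      Module.finrank k X * Module.finrank k Y := by
  rw [finrank_quot_tensor_hom, ← finrank_homMod]
  exact Submodule.finrank_le _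

theorem finrank_quot_tensor_hom_eq_iff (X Y : AlgModule.{u, v, v} k H) [Module.Finite k X]
    [Module.Finite k Y] :
    Module.finrank k ((quot (k := k) J).tensor X →ₗ[H] Y) =
      Module.finrank k X * Module.finrank k Y ↔ ∀ h ∈ J, ∀ φ : X.homMod Y, h • φ = 0 := by
  rw [finrank_quot_tensor_hom, ← finrank_homMod]
  constructor
  · intro h a ha φ
    have : φ ∈ invariants J (X.homMod Y) := by
      rw [Submodule.eq_top_of_finrank_eq h]
      trivial
    exact this a ha
  · intro h
    have : invariants J (X.homMod Y) = ⊤ := eq_top_iff.2 fun φ _ a ha => h a ha φ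
    rw [this, finrank_top]

variable [(J.restrictScalars k).IsCoideal]

theorem tmul_mem_invariants {V X : AlgModule.{u, v, v} k H} {v : V} {x : X}
    (hv : v ∈ invariants J V) (hx : x ∈ invariants J X) :
    tmul V X v x ∈ invariants J (V.tensor X) := fun _ hh =>
  smul_tmul_eq_zero (Submodule.IsCoideal.map_mkQ_comul_eq_zero (R := k) hh) hv hx

variable [J.IsTwoSided]

/-- Tensoring homomorphisms `H/J ⊗ X → Y` with vectors of `H/J` yields homomorphisms
`H/J ⊗ X → H/J ⊗ Y`, because `H/J ⊗ Hom_k(X, Y)` embeds into `Hom_k(X, H/J ⊗ Y)`. -/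
theorem finrank_quot_mul_le (X Y : AlgModule.{u, v, v} k H) [Module.Finite k X]
    [Module.Finite k Y] [Module.Finite k (H ⧸ J)] :
    Module.finrank k (H ⧸ J) * Module.finrank k ((quot (k := k) J).tensor X →ₗ[H] Y) ≤
      Module.finrank k ((quot (k := k) J).tensor X →ₗ[H] (quot (k := k) J).tensor Y) := by
  have : Module.Finite k (quot (k := k) J) := inferInstanceAs (Module.Finite k (H ⧸ J))
  rw [finrank_quot_tensor_hom, finrank_quot_tensor_hom]
  let N := invariants J (X.homMod Y)
  let R := quot (k := k) J
  let f : R ⊗[k] N →ₗ[k] R.tensor (X.homMod Y) := N.subtype.lTensor R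
  have hf : Function.Injective f := Module.Flat.lTensor_preserves_injective_linearMap
    (M := R) N.subtype N.injective_subtype
  let g : R ⊗[k] N →ₗ[k] X.homMod (R.tensor Y) := (tensorHomMod R X Y).restrictScalars k ∘ₗ f
  have hg : Function.Injective g := (tensorHomMod_bijective (V := R)).1.comp hf
  have hmem : ∀ x, g x ∈ invariants J (X.homMod (R.tensor Y)) := by
    intro x
    induction x with
    | zero => rw [map_zero]; exact zero_mem _
    | add x y hx hy => rw [map_add]; exact add_mem hx hy
    | tmul b n =>
      intro h hh
      change h • tensorHomMod R X Y (tmul R _ b n) = 0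
      rw [← map_smul, tmul_mem_invariants J (fun a ha => smul_quot J ha b) n.2 h hh, map_zero]
  have := LinearMap.finrank_le_finrank_of_injective (f := g.codRestrict _ hmem)
    fun x y hxy => hg (congrArg Subtype.val hxy)
  rwa [Module.finrank_tensorProduct] at this

/-- If `W` is a quotient of `H/J ⊗ U`, then `H/J ⊗ W` is generated by images of `H/J ⊗ U`. -/
theorem smul_quot_tensor_of_surjective {U W : AlgModule.{u, v, v} k H}
    (f : (quot (k := k) J).tensor U →ₗ[H] W) (hf : Function.Surjective f) {a : H}
    (ha : ∀ x : (quot (k := k) J).tensor U, a • x = 0) (x : (quot (k := k) J).tensor W) :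
    a • x = 0 := by
  have key : ∀ (b : quot (k := k) J) (y : (quot (k := k) J).tensor U),
      a • tmul (quot J) W b (f y) = 0 := by
    intro b y
    induction y using tensor_induction with
    | zero => rw [map_zero, map_zero, smul_zero]
    | add x y hx hy => rw [map_add, map_add, smul_add, hx, hy, add_zero]
    | tmul b' u =>
      let q := curryEquiv _ _ _ f b'
      have hq : q ∈ invariants J (U.homMod W) := fun h hh => by
        rw [← map_smul, smul_quot J hh, map_zero]
      have hφ : tensorHomMod (quot J) U W (tmul _ _ b q) ∈
          invariants J (U.homMod ((quot J).tensor W)) := fun h hh => by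
        rw [← map_smul, tmul_mem_invariants J (fun a ha => smul_quot J ha b) hq h hh, map_zero]
      let F := (curryEquiv (quot J) U ((quot J).tensor W)).symm
        ((quotHomEquiv J _).symm ⟨_, hφ⟩)
      have hF : F (tmul (quot J) U (quotMk J 1) u) =
          tmul (quot J) W b (f (tmul (quot J) U b' u)) := by
        rw [curryEquiv_symm_apply, quotHomEquiv_symm_mk_one, tensorHomMod_apply,
          curryEquiv_apply]
      rw [← hF, ← map_smul, ha, map_zero]
  induction x using tensor_induction with
  | zero => rw [smul_zero]
  | add x y hx hy => rw [smul_add, hx, hy, add_zero]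
  | tmul b w =>
    obtain ⟨y, rfl⟩ := hf w
    exact key b y

end AlgModule

/-! ### Duals, quotient algebras and the Chevalley property -/

namespace AlgModule

section Descend

variable {k : Type u} {A : Type v} [Field k] [Ring A] [Algebra k A] {I : Ideal A} [I.IsTwoSided]

theorem restrict_mk_smul (W : AlgModule.{u, v, w} k (A ⧸ I)) {a : A} (ha : a ∈ I)
    (x : W.restrict (Ideal.Quotient.mkₐ k I)) : a • x = 0 := by
  change Ideal.Quotient.mkₐ k I a • (show W from x) = 0
  rw [show Ideal.Quotient.mkₐ k I a = 0 from Ideal.Quotient.eq_zero_iff_mem.2 ha, zero_smul]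

/-- Homomorphisms from a descended module are the homomorphisms of `A`-modules. -/
def descendHomRestrict (M : AlgModule.{u, v, w} k A) (h : ∀ a ∈ I, ∀ x : M, a • x = 0)
    (W : AlgModule.{u, v, w'} k (A ⧸ I)) :
    (M.descend I h →ₗ[A ⧸ I] W) ≃ₗ[k] (M →ₗ[A] W.restrict (Ideal.Quotient.mkₐ k I)) where
  toFun f :=
    { toFun := f
      map_add' := f.map_add
      map_smul' := fun a x => f.map_smul (Ideal.Quotient.mk I a) x }
  invFun f :=
    { toFun := f
      map_add' := f.map_add
      map_smul' := fun a x => by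
        obtain ⟨a, rfl⟩ := Ideal.Quotient.mk_surjective a
        exact f.map_smul a x }
  map_add' f g := rfl
  map_smul' r f := rfl
  left_inv f := rfl
  right_inv f := rfl

/-- Homomorphisms to a descended module are the homomorphisms of `A`-modules. -/
def restrictHomDescend (M : AlgModule.{u, v, w} k A) (h : ∀ a ∈ I, ∀ x : M, a • x = 0)
    (W : AlgModule.{u, v, w'} k (A ⧸ I)) :
    (W →ₗ[A ⧸ I] M.descend I h) ≃ₗ[k] (W.restrict (Ideal.Quotient.mkₐ k I) →ₗ[A] M) where
  toFun f :=
    { toFun := f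
      map_add' := f.map_add
      map_smul' := fun a x => f.map_smul (Ideal.Quotient.mk I a) x }
  invFun f :=
    { toFun := f
      map_add' := f.map_add
      map_smul' := fun a x => by
        obtain ⟨a, rfl⟩ := Ideal.Quotient.mk_surjective a
        exact f.map_smul a x }
  map_add' f g := rfl
  map_smul' r f := rfl
  left_inv f := rfl
  right_inv f := rfl

/-- Homomorphisms between descended modules are the homomorphisms of `A`-modules. -/
def descendHomDescend (M : AlgModule.{u, v, w} k A) (h : ∀ a ∈ I, ∀ x : M, a • x = 0)
    (N : AlgModule.{u, v, w'} k A) (h' : ∀ a ∈ I, ∀ x : N, a • x = 0) :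
    (M.descend I h →ₗ[A ⧸ I] N.descend I h') ≃ₗ[k] (M →ₗ[A] N) where
  toFun f :=
    { toFun := f
      map_add' := f.map_add
      map_smul' := fun a x => f.map_smul (Ideal.Quotient.mk I a) x }
  invFun f :=
    { toFun := f
      map_add' := f.map_add
      map_smul' := fun a x => by
        obtain ⟨a, rfl⟩ := Ideal.Quotient.mk_surjective a
        exact f.map_smul a x }
  map_add' f g := rfl
  map_smul' r f := rfl
  left_inv f := rfl
  right_inv f := rfl

end Descend

section Dual

variable {k : Type u} {H : Type v} [Field k] [Ring H] [HopfAlgebra k H]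

/-- The natural map `Y ⊗ X* → Hom_k(X, Y)`. -/
noncomputable def tensorDualHom (X : AlgModule.{u, v, w} k H) (Y : AlgModule.{u, v, w} k H) :
    Y.tensor X.dual →ₗ[H] X.homMod Y :=
  tensorHom (V := Y) (W := X.dual) (tensorLift (V := Y) (W := X.dual)
      (LinearMap.flip (R₂ := k) (M := Module.Dual k X) (N := Y)
        ((LinearMap.smulRightₗ (R := k) (M := Y) (M₂ := X)))))
    fun h y ξ => by
      let r := Coalgebra.Repr.arbitrary k h
      rw [smul_tmul h r, map_sum]
      apply homMod.of.symm.injective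
      ext x
      rw [homMod.smul_apply h r, map_sum, LinearMap.sum_apply]
      refine Finset.sum_congr rfl fun i _ => ?_
      exact (smul_comm (r.left i)
        ((show Module.Dual k X from ξ) (HopfAlgebra.antipode k (r.right i) • x)) y).symm

theorem tensorDualHom_bijective (X : AlgModule.{u, v, w} k H) (Y : AlgModule.{u, v, w} k H)
    [Module.Finite k X] : Function.Bijective (tensorDualHom X Y) := by
  have h := ((TensorProduct.comm k Y (Module.Dual k X)).trans
    (dualTensorHomEquiv k X Y)).bijective
  have h2 : (⇑(tensorDualHom X Y) : Y ⊗[k] Module.Dual k X → (X →ₗ[k] Y)) =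
      (TensorProduct.comm k Y (Module.Dual k X)).trans (dualTensorHomEquiv k X Y) := by
    have : (((tensorDualHom X Y).restrictScalars k : _ →ₗ[k] _) :
        Y ⊗[k] Module.Dual k X →ₗ[k] (X →ₗ[k] Y)) =
      ((TensorProduct.comm k Y (Module.Dual k X)).trans (dualTensorHomEquiv k X Y)).toLinearMap :=
      TensorProduct.ext' fun y ξ => by
        refine LinearMap.ext (M := X) (M₃ := Y) fun x => ?_
        rfl
    exact congrArg DFunLike.coe this
  rw [← h2] at h
  exact h

end Dual

end AlgModule

open AlgModule in
/-- By the Chevalley property the Jacobson radical annihilates tensor products of completely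
reducible modules. -/
theorem HasChevalleyProperty.smul_tensor {k : Type u} {A : Type v} [Field k] [Ring A]
    [HopfAlgebra k A] [Module.Finite k A] (hA : HasChevalleyProperty k A)
    (V W : AlgModule.{u, v, v} k A) [IsSemisimpleModule A V] [IsSemisimpleModule A W] {a : A}
    (ha : a ∈ Ring.jacobson A) (v : V) (w : W) : a • tmul V W v w = 0 := by
  have key : ∀ (S : Submodule A V) (T : Submodule A W), IsSimpleModule A S → IsSimpleModule A T →
      ∀ (v : S) (w : T), a • tmul V W v w = 0 := by
    intro S T hS hT v w
    let S' : AlgModule.{u, v, v} k A := { carrier := S }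
    let T' : AlgModule.{u, v, v} k A := { carrier := T }
    have : Module.Finite k S := Module.Finite.trans A S
    have : Module.Finite k T := Module.Finite.trans A T
    have := hA S' T' ‹_› ‹_› hS hT
    let f : S'.tensor T' →ₗ[k] V.tensor W := tensorLift (V := S') (W := T')
      ((tmul V W).compl₁₂ (S.subtype.restrictScalars k) (T.subtype.restrictScalars k))
    have h1 : a • tmul S' T' v w = 0 := jacobson_smul_of_isSemisimpleModule ha _
    let r := Coalgebra.Repr.arbitrary k a
    have h2 : f (a • tmul S' T' v w) = a • tmul V W v w := by
      rw [smul_tmul a r, smul_tmul a r, map_sum]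
      rfl
    rw [← h2, h1, map_zero]
  have hv : v ∈ sSup {m : Submodule A V | IsSimpleModule A m} := by
    rw [IsSemisimpleModule.sSup_simples_eq_top]; trivial
  have hw : w ∈ sSup {m : Submodule A W | IsSimpleModule A m} := by
    rw [IsSemisimpleModule.sSup_simples_eq_top]; trivial
  rw [sSup_eq_iSup'] at hv hw
  induction hv using Submodule.iSup_induction' with
  | zero => rw [map_zero, LinearMap.zero_apply, smul_zero]
  | add x y _ _ hx hy => rw [map_add, LinearMap.add_apply, smul_add, hx, hy, add_zero]
  | mem S x hx =>
    induction hw using Submodule.iSup_induction' with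
    | zero => rw [map_zero, smul_zero]
    | add x y _ _ hx hy => rw [map_add, smul_add, hx, hy, add_zero]
    | mem T y hy => exact key S.1 T.1 S.2 T.2 ⟨x, hx⟩ ⟨y, hy⟩

section Radical

variable {k : Type u} {A : Type v} [Field k] [Ring A] [Algebra k A] [Module.Finite k A]

theorem map_eq_zero_of_mem_jacobson (ε : A →ₐ[k] k) {a : A} (ha : a ∈ Ring.jacobson A) :
    ε a = 0 := by
  have := IsArtinianRing.of_finite k A
  obtain ⟨n, hn⟩ : IsNilpotent (Ring.jacobson A) := IsSemiprimaryRing.isNilpotent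
  have h : a ^ n = 0 := by
    have := Ideal.pow_mem_pow ha n
    rwa [hn] at this
  have h2 : ε a ^ n = 0 := by rw [← map_pow, h, map_zero]
  exact eq_zero_of_pow_eq_zero h2

/-- The trivial module of an augmented algebra is a direct summand of `A/Jac(A)`. -/
theorem exists_integral_mod_jacobson (ε : A →ₐ[k] k) :
    ∃ t : A, (∀ a, a * t - ε a • t ∈ Ring.jacobson A) ∧ ε t = 1 := by
  have : IsSemisimpleModule A (A ⧸ Ring.jacobson A) := isSemisimpleModule_quotient_jacobson k A
  let K : Submodule A (A ⧸ Ring.jacobson A) := Submodule.map (Ring.jacobson A).mkQ (RingHom.ker ε)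
  obtain ⟨P, hP⟩ := exists_isCompl K
  have h1 : (Ring.jacobson A).mkQ 1 ∈ K ⊔ P := by rw [hP.sup_eq_top]; trivial
  obtain ⟨_, ⟨c, hc, rfl⟩, y, hy, hcy⟩ := Submodule.mem_sup.1 h1
  obtain ⟨t, rfl⟩ := (Ring.jacobson A).mkQ_surjective y
  have hc' : ε c = 0 := hc
  have ht1 : ε t = 1 := by
    rw [← map_add] at hcy
    have h := map_eq_zero_of_mem_jacobson ε ((Submodule.Quotient.eq _).1 hcy)
    rw [map_sub, map_add, hc', map_one, zero_add, sub_eq_zero] at h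
    exact h
  refine ⟨t, fun a => ?_, ht1⟩
  rw [← Submodule.Quotient.mk_eq_zero]
  have hmem : (Ring.jacobson A).mkQ (a * t - ε a • t) ∈ K ⊓ P := by
    refine ⟨⟨_, ?_, rfl⟩, ?_⟩
    · change ε (a * t - ε a • t) = 0
      rw [map_sub, map_mul, map_smul, ht1, smul_eq_mul, sub_self]
    · have : a * t - ε a • t = (a - algebraMap k A (ε a)) • t := by
        rw [smul_eq_mul, sub_mul, Algebra.smul_def]
      rw [this, map_smul]
      exact P.smul_mem _ hy
  rw [hP.inf_eq_bot] at hmem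
  exact hmem

end Radical

/-! ### Fiber algebras -/

namespace CentralHopfSubalgebra

open AlgModule

section Fiber

variable {k : Type u} {H : Type v} [Field k] [Ring H] [HopfAlgebra k H]
  (C : CentralHopfSubalgebra k H)

theorem smul_eq_zero_of_mem_fiberIdeal {𝔪 : Ideal C.toSubalgebra} {M : Type*} [AddCommGroup M]
    [Module H M] (h0 : ∀ c ∈ 𝔪, ∀ x : M, (c : H) • x = 0) :
    ∀ h ∈ C.fiberIdeal 𝔪, ∀ x : M, h • x = 0 := by
  intro h hh
  induction hh using Submodule.span_induction with
  | mem x hx => obtain ⟨c, hc, rfl⟩ := hx; exact h0 c hc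
  | zero => simp
  | add x y _ _ hx hy => intro z; rw [add_smul, hx, hy, add_zero]
  | smul a x _ hx => intro z; rw [smul_eq_mul, mul_smul, hx, smul_zero]

theorem coe_mem_fiberIdeal {𝔪 : Ideal C.toSubalgebra} {c : C.toSubalgebra} (hc : c ∈ 𝔪) :
    (c : H) ∈ C.fiberIdeal 𝔪 := Ideal.subset_span ⟨c, hc, rfl⟩

theorem fiberIdeal_smul_inflate {C : CentralHopfSubalgebra k H} {𝔪 : Ideal C.toSubalgebra}
    (X : AlgModule.{u, v, w} k (C.Fiber 𝔪)) :
    ∀ h ∈ C.fiberIdeal 𝔪, ∀ x : C.inflate X, h • x = 0 :=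
  fun _ hh x => restrict_mk_smul X hh x

theorem smul_eq_of_sub_mem {𝔪 : Ideal C.toSubalgebra} {X : AlgModule.{u, v, w} k H}
    (hX : ∀ h ∈ C.fiberIdeal 𝔪, ∀ x : X, h • x = 0) {c : C.toSubalgebra} {r : k}
    (hr : c - algebraMap k C.toSubalgebra r ∈ 𝔪) (x : X) : (c : H) • x = r • x := by
  have h := hX _ (C.coe_mem_fiberIdeal hr) x
  have h' : ((c - algebraMap k C.toSubalgebra r : C.toSubalgebra) : H) =
      (c : H) - algebraMap k H r := rfl
  rwa [h', sub_smul, sub_eq_zero, algebraMap_smul] at h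

theorem counitIdeal_isMaximal : C.counitIdeal.IsMaximal := by
  refine RingHom.ker_isMaximal_of_surjective
    ((Bialgebra.counitAlgHom k H).comp C.toSubalgebra.val) fun r => ?_
  exact ⟨algebraMap k _ r, AlgHom.commutes _ r⟩

/-- The fiber algebras are nonzero, by Nakayama's lemma for the `C`-module `H`. -/
theorem nontrivial_fiber [Module.Finite C.toSubalgebra H] {𝔪 : Ideal C.toSubalgebra}
    (h𝔪 : 𝔪.IsMaximal) :
    Nontrivial (C.Fiber 𝔪) := by
  rw [Ideal.Quotient.nontrivial_iff]
  intro htop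
  let : CommRing C.toSubalgebra :=
    { (inferInstance : Ring C.toSubalgebra) with
      mul_comm := fun a b => Subtype.ext (C.central a a.2 b) }
  have hle : (⊤ : Submodule C.toSubalgebra H) ≤ 𝔪 • ⊤ := by
    intro x _
    have hx : x ∈ C.fiberIdeal 𝔪 := by rw [htop]; trivial
    induction hx using Submodule.span_induction with
    | mem x hx =>
      obtain ⟨c, hc, rfl⟩ := hx
      have : (c : H) = c • (1 : H) := (mul_one (c : H)).symm
      rw [this]
      exact Submodule.smul_mem_smul hc trivial
    | zero => exact zero_mem _
    | add x y _ _ hx hy => exact add_mem (hx trivial) (hy trivial)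
    | smul a x _ hx =>
      refine Submodule.smul_induction_on (hx trivial) (fun c hc y _ => ?_) fun y z hy hz => ?_
      · have : a • c • y = c • (a * y) := by
          change a * ((c : H) * y) = (c : H) * (a * y)
          rw [← mul_assoc, ← C.central c c.2 a, mul_assoc]
        rw [this]
        exact Submodule.smul_mem_smul hc trivial
      · rw [smul_add]
        exact add_mem hy hz
  obtain ⟨r, hr, hr0⟩ := Submodule.exists_sub_one_mem_and_smul_eq_zero_of_fg_of_le_smul 𝔪 ⊤
    (Module.Finite.fg_top (R := C.toSubalgebra) (M := H)) hle
  have h0 : r = 0 := Subtype.ext ((mul_one (r : H)).symm.trans (hr0 1 trivial))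
  refine h𝔪.ne_top ((Ideal.eq_top_iff_one 𝔪).2 ?_)
  rw [h0, zero_sub] at hr
  simpa using 𝔪.neg_mem hr

/-- If `V` is a module over the identity fiber and `X` one over the fiber at `𝔪`, then `V ⊗ X` is a
module over the fiber at `𝔪`. -/
theorem fiberIdeal_smul_tensor {𝔪 : Ideal C.toSubalgebra} {V X : AlgModule.{u, v, v} k H}
    (hV : ∀ h ∈ C.fiberIdeal C.counitIdeal, ∀ x : V, h • x = 0)
    (hX : ∀ h ∈ C.fiberIdeal 𝔪, ∀ x : X, h • x = 0) :
    ∀ h ∈ C.fiberIdeal 𝔪, ∀ x : V.tensor X, h • x = 0 := by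
  refine C.smul_eq_zero_of_mem_fiberIdeal fun c hc y => ?_
  obtain ⟨t, ht⟩ := C.comul_mem c c.2
  have hscal : ∀ (a : C.toSubalgebra) (v : V),
      (a : H) • v = Coalgebra.counit (R := k) (a : H) • v := by
    intro a v
    refine C.smul_eq_of_sub_mem hV (r := Coalgebra.counit (R := k) (a : H)) ?_ v
    rw [mem_counitIdeal]
    simp
  have key : ∀ (t : C.toSubalgebra ⊗[k] C.toSubalgebra) (v : V) (x : X),
      TensorProduct.map (V.orbit v) (X.orbit x)
        (TensorProduct.map C.toSubalgebra.val.toLinearMap C.toSubalgebra.val.toLinearMap t) =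
      tmul V X v (TensorProduct.lid k H ((Coalgebra.counit (R := k) (A := H)).rTensor H
        (TensorProduct.map C.toSubalgebra.val.toLinearMap C.toSubalgebra.val.toLinearMap t)) •
          x) := by
    intro t v x
    induction t with
    | zero => simp only [map_zero, zero_smul]; rfl
    | add a b ha hb => simp only [map_add, ha, hb, add_smul]; rfl
    | tmul a b =>
      simp only [TensorProduct.map_tmul, LinearMap.rTensor_tmul, TensorProduct.lid_tmul,
        AlgHom.toLinearMap_apply, Subalgebra.coe_val, orbit_apply, hscal]
      rw [smul_assoc, LinearMap.map_smul, ← TensorProduct.smul_tmul']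
      rfl
  induction y using tensor_induction with
  | zero => rw [smul_zero]
  | add x y hx hy => rw [smul_add, hx, hy, add_zero]
  | tmul v x =>
    rw [smul_tmul_eq_map, ← ht, key, ht, Coalgebra.rTensor_counit_comul, TensorProduct.lid_tmul,
      one_smul, hX _ (C.coe_mem_fiberIdeal hc), map_zero]

end Fiber

section Radical

variable {k : Type u} {H : Type v} [Field k] [Ring H] [HopfAlgebra k H]
  (C : CentralHopfSubalgebra k H)

/-- The preimage in `H` of the Jacobson radical of the identity fiber algebra. -/
def radIdeal : Ideal H :=
  RingHom.ker ((Ideal.Quotient.mkₐ k (Ring.jacobson (C.Fiber C.counitIdeal))).comp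
    (Ideal.Quotient.mkₐ k (C.fiberIdeal C.counitIdeal)))

instance : C.radIdeal.IsTwoSided := by
  unfold radIdeal
  infer_instance

theorem mem_radIdeal (h : H) : h ∈ C.radIdeal ↔
    Ideal.Quotient.mk (C.fiberIdeal C.counitIdeal) h ∈ Ring.jacobson (C.Fiber C.counitIdeal) :=
  Ideal.Quotient.eq_zero_iff_mem

theorem fiberIdeal_le_radIdeal : C.fiberIdeal C.counitIdeal ≤ C.radIdeal := fun h hh => by
  rw [mem_radIdeal, Ideal.Quotient.eq_zero_iff_mem.2 hh]
  exact zero_mem _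

/-- `H` modulo the preimage of the radical is the semisimple quotient of the identity fiber. -/
noncomputable def quotRadIdealEquiv : (H ⧸ C.radIdeal) ≃ₐ[k]
    (C.Fiber C.counitIdeal ⧸ Ring.jacobson (C.Fiber C.counitIdeal)) :=
  Ideal.quotientKerAlgEquivOfSurjective
    (f := (Ideal.Quotient.mkₐ k (Ring.jacobson (C.Fiber C.counitIdeal))).comp
      (Ideal.Quotient.mkₐ k (C.fiberIdeal C.counitIdeal)))
    (Ideal.Quotient.mk_surjective.comp Ideal.Quotient.mk_surjective)

variable [Module.Finite k (C.Fiber C.counitIdeal)]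

/-- By the Chevalley property, the Jacobson radical of the identity fiber is a coideal. -/
theorem isCoideal_radIdeal (hC : HasChevalleyProperty k (C.Fiber C.counitIdeal)) :
    (C.radIdeal.restrictScalars k).IsCoideal where
  counit_eq_zero h hh :=
    map_eq_zero_of_mem_jacobson (Bialgebra.counitAlgHom k (C.Fiber C.counitIdeal))
      ((C.mem_radIdeal h).1 hh)
  map_mkQ_comul_eq_zero h hh := by
    let B := C.Fiber C.counitIdeal
    let Q : AlgModule.{u, v, v} k B := quot (Ring.jacobson B)
    have : IsSemisimpleModule B Q := isSemisimpleModule_quotient_jacobson k B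
    have h1 := hC.smul_tensor Q Q ((C.mem_radIdeal h).1 hh) (quotMk _ 1) (quotMk _ 1)
    rw [smul_tmul_eq_map] at h1
    let φ : (H ⧸ C.radIdeal.restrictScalars k) ≃ₗ[k] Q := C.quotRadIdealEquiv.toLinearEquiv
    have hφ : Q.orbit (quotMk _ 1) ∘ₗ
        (Ideal.Quotient.mkₐ k (C.fiberIdeal C.counitIdeal)).toLinearMap =
          φ.toLinearMap ∘ₗ (C.radIdeal.restrictScalars k).mkQ := by
      refine LinearMap.ext fun a => ?_
      change (Submodule.Quotient.mk (Ideal.Quotient.mk (C.fiberIdeal C.counitIdeal) a • (1 : B)) :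
        B ⧸ Ring.jacobson B) = Submodule.Quotient.mk (Ideal.Quotient.mk _ a)
      rw [smul_eq_mul, mul_one]
    have h2 : Coalgebra.comul (R := k) (Ideal.Quotient.mk (C.fiberIdeal C.counitIdeal) h) =
        TensorProduct.map (Ideal.Quotient.mkₐ k (C.fiberIdeal C.counitIdeal)).toLinearMap
          (Ideal.Quotient.mkₐ k (C.fiberIdeal C.counitIdeal)).toLinearMap
          (Coalgebra.comul (R := k) h) := rfl
    rw [h2, ← LinearMap.comp_apply, ← TensorProduct.map_comp, hφ, TensorProduct.map_comp,
      LinearMap.comp_apply] at h1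
    exact (TensorProduct.congr φ φ).injective (h1.trans (map_zero _).symm)

/-- An integral of the semisimple quotient of the identity fiber. -/
theorem exists_integral_mod_radIdeal : ∃ t : H,
    (∀ h, h * t - Coalgebra.counit (R := k) h • t ∈ C.radIdeal) ∧
      Coalgebra.counit (R := k) t = 1 := by
  obtain ⟨t, ht, ht1⟩ := exists_integral_mod_jacobson
    (Bialgebra.counitAlgHom k (C.Fiber C.counitIdeal))
  obtain ⟨t, rfl⟩ := Ideal.Quotient.mk_surjective t
  exact ⟨t, fun h => (C.mem_radIdeal _).2 (ht (Ideal.Quotient.mk _ h)), ht1⟩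

/-- A nonzero finite-dimensional module over the identity fiber contains a nonzero vector
annihilated by the radical. -/
theorem finrank_invariants_radIdeal_pos (Q : AlgModule.{u, v, w} k H) [Module.Finite k Q]
    [Nontrivial Q] (hQ : ∀ h ∈ C.fiberIdeal C.counitIdeal, ∀ x : Q, h • x = 0) :
    0 < Module.finrank k (invariants C.radIdeal Q) := by
  let D := Q.descend _ hQ
  have : Module.Finite k D := inferInstanceAs (Module.Finite k Q)
  have : Nontrivial D := inferInstanceAs (Nontrivial Q)
  have := IsArtinianRing.of_finite k (C.Fiber C.counitIdeal)
  have : Module.Finite (C.Fiber C.counitIdeal) D := .of_restrictScalars_finite k _ D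
  obtain ⟨S, hS, _⟩ :=
    (eq_bot_or_exists_atom_le (⊤ : Submodule (C.Fiber C.counitIdeal) D)).resolve_left top_ne_bot
  have : IsSimpleModule (C.Fiber C.counitIdeal) S := isSimpleModule_iff_isAtom.2 hS
  have : Nontrivial S := IsSimpleModule.nontrivial (C.Fiber C.counitIdeal) S
  obtain ⟨x, hx⟩ := exists_ne (0 : S)
  have hinv : (x : D) ∈ invariants C.radIdeal Q := fun h hh =>
    congrArg Subtype.val (jacobson_smul_of_isSemisimpleModule ((C.mem_radIdeal h).1 hh) x)
  have : Nontrivial (invariants C.radIdeal Q) :=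
    ⟨⟨⟨(x : D), hinv⟩, 0, fun h => hx (Subtype.ext
      (congrArg (fun y : invariants C.radIdeal Q => (y : Q)) h))⟩⟩
  exact Module.finrank_pos

/-- Complete reducibility of a module over the identity fiber, in terms of the `H`-action. -/
theorem isSemisimpleModule_descend_iff (Q : AlgModule.{u, v, w} k H)
    (hQ : ∀ h ∈ C.fiberIdeal C.counitIdeal, ∀ x : Q, h • x = 0) :
    IsSemisimpleModule (C.Fiber C.counitIdeal) (Q.descend _ hQ) ↔
      ∀ h ∈ C.radIdeal, ∀ x : Q, h • x = 0 := by
  constructor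
  · intro hs h hh x
    exact jacobson_smul_of_isSemisimpleModule (M := Q.descend _ hQ) ((C.mem_radIdeal h).1 hh) x
  · intro h
    refine isSemisimpleModule_of_jacobson_smul (k := k) fun a ha x => ?_
    obtain ⟨a, rfl⟩ := Ideal.Quotient.mk_surjective a
    exact h a ((C.mem_radIdeal a).2 ha) x

end Radical

section Residue

variable {k : Type u} {H : Type v} [Field k] [IsAlgClosed k] [Ring H] [HopfAlgebra k H]
  [Algebra.FiniteType k H] (C : CentralHopfSubalgebra k H) [Module.Finite C.toSubalgebra H]

theorem finite_fiber {𝔪 : Ideal C.toSubalgebra} (h𝔪 : 𝔪.IsMaximal) :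
    Module.Finite k (C.Fiber 𝔪) := by
  obtain ⟨s, hs⟩ := Module.Finite.fg_top (R := C.toSubalgebra) (M := H)
  classical
  refine ⟨⟨s.image (Ideal.Quotient.mk (C.fiberIdeal 𝔪)), ?_⟩⟩
  rw [eq_top_iff]
  rintro x -
  obtain ⟨x, rfl⟩ := Ideal.Quotient.mk_surjective x
  have hx : x ∈ Submodule.span C.toSubalgebra (s : Set H) := by rw [hs]; trivial
  induction hx using Submodule.span_induction with
  | mem x hx => exact Submodule.subset_span (by simpa using ⟨x, hx, rfl⟩)
  | zero => rw [map_zero]; exact zero_mem _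
  | add x y _ _ hx hy => rw [map_add]; exact add_mem hx hy
  | smul c x _ hx =>
    obtain ⟨r, hr⟩ := C.exists_sub_algebraMap_mem 𝔪 h𝔪 c
    have : Ideal.Quotient.mk (C.fiberIdeal 𝔪) (c • x) =
        r • Ideal.Quotient.mk (C.fiberIdeal 𝔪) x := by
      rw [← sub_eq_zero]
      refine Ideal.Quotient.eq_zero_iff_mem.2 (?_ : (c : H) * x - r • x ∈ _)
      have h := Ideal.mul_mem_right x _ (C.coe_mem_fiberIdeal hr)
      have h' : ((c - algebraMap k C.toSubalgebra r : C.toSubalgebra) : H) =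
        (c : H) - algebraMap k H r := rfl
      rwa [h', sub_mul, ← Algebra.smul_def] at h
    rw [this]
    exact Submodule.smul_mem _ r hx

/-- Linear maps between modules over the same fiber form a module over the identity fiber. -/
theorem fiberIdeal_smul_homMod {𝔪 : Ideal C.toSubalgebra} (h𝔪 : 𝔪.IsMaximal)
    {X Y : AlgModule.{u, v, v} k H} (hX : ∀ h ∈ C.fiberIdeal 𝔪, ∀ x : X, h • x = 0)
    (hY : ∀ h ∈ C.fiberIdeal 𝔪, ∀ x : Y, h • x = 0) :
    ∀ h ∈ C.fiberIdeal C.counitIdeal, ∀ φ : X.homMod Y, h • φ = 0 := by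
  refine C.smul_eq_zero_of_mem_fiberIdeal fun c hc φ => ?_
  obtain ⟨t, ht⟩ := C.comul_mem c c.2
  have key : ∀ (t : C.toSubalgebra ⊗[k] C.toSubalgebra) (φ : X →ₗ[k] Y) (x : X),
      homAction X Y
        (TensorProduct.map C.toSubalgebra.val.toLinearMap C.toSubalgebra.val.toLinearMap t) φ x =
      φ (LinearMap.mul' k H ((HopfAlgebra.antipode k).lTensor H
        (TensorProduct.map C.toSubalgebra.val.toLinearMap C.toSubalgebra.val.toLinearMap t)) •
          x) := by
    intro t φ x
    induction t with
    | zero => simp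
    | add a b ha hb => simp only [map_add, LinearMap.add_apply, ha, hb, add_smul]
    | tmul a b =>
      obtain ⟨r, hr⟩ := C.exists_sub_algebraMap_mem 𝔪 h𝔪 a
      change (a : H) • φ (HopfAlgebra.antipode k (b : H) • x) =
        φ (((a : H) * HopfAlgebra.antipode k (b : H)) • x)
      rw [C.smul_eq_of_sub_mem hY hr, mul_smul, C.smul_eq_of_sub_mem hX hr, LinearMap.map_smul φ]
  refine LinearMap.ext (M := X) (M₃ := Y) fun x => ?_
  have h0 : Coalgebra.counit (R := k) (c : H) = 0 := hc
  refine (congrArg (fun s => homAction X Y s φ x) ht.symm).trans ((key t φ x).trans ?_)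
  rw [ht, HopfAlgebra.mul_antipode_lTensor_comul_apply, h0, map_zero, zero_smul]
  exact LinearMap.map_zero (homMod.of.symm φ)

end Residue

end CentralHopfSubalgebra

/-! ### Multiplicities in tensor products with the semisimple identity fiber -/

/-- Conjugation with `e` is an isomorphism from `Hom_k(X, X)` to `Hom_k(Y, Y)`. -/
theorem AlgModule.homMod_smul_eq_zero_of_equiv {k : Type u} {H : Type v} [Field k] [Ring H]
    [HopfAlgebra k H] {X Y : AlgModule.{u, v, w} k H} (e : X ≃ₗ[H] Y) {h : H}
    (hY : ∀ φ : Y.homMod Y, h • φ = 0) (φ : X.homMod X) : h • φ = 0 := by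
  let r := Coalgebra.Repr.arbitrary k h
  let ψ : Y.homMod Y := homMod.of ((e.toLinearMap.restrictScalars k) ∘ₗ homMod.of.symm φ ∘ₗ
    (e.symm.toLinearMap.restrictScalars k))
  apply homMod.of.symm.injective
  refine LinearMap.ext fun x => e.injective ?_
  have h1 : homMod.of.symm (h • ψ) (e x) = e (homMod.of.symm (h • φ) x) := by
    rw [homMod.smul_apply h r, homMod.smul_apply h r, map_sum]
    refine Finset.sum_congr rfl fun i _ => ?_
    change r.left i • e (homMod.of.symm φ (e.symm _)) = _
    rw [e.symm.map_smul, e.map_smul, e.symm_apply_apply]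
  rw [← h1, hY]
  exact (map_zero e).symm

namespace CentralHopfSubalgebra

open AlgModule

section RadTensor

variable {k : Type u} {H : Type v} [Field k] [Ring H] [HopfAlgebra k H]
  {C : CentralHopfSubalgebra k H} {𝔪 : Ideal C.toSubalgebra}

/-- The module `H/J ⊗ X` over the fiber algebra, where `H/J` is the semisimple quotient of the
identity fiber. -/
noncomputable def radTensor (X : AlgModule.{u, v, v} k (C.Fiber 𝔪)) :
    AlgModule.{u, v, v} k (C.Fiber 𝔪) :=
  ((quot C.radIdeal).tensor (C.inflate X)).descend _ (C.fiberIdeal_smul_tensor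
    (fun _ hh x => smul_quot _ (C.fiberIdeal_le_radIdeal hh) x) (fiberIdeal_smul_inflate X))

theorem finrank_radTensor_hom (X Y : AlgModule.{u, v, v} k (C.Fiber 𝔪)) :
    Module.finrank k (radTensor X →ₗ[C.Fiber 𝔪] Y) =
      Module.finrank k ((quot (k := k) C.radIdeal).tensor (C.inflate X) →ₗ[H] C.inflate Y) :=
  (descendHomRestrict _ _ Y).finrank_eq

theorem finrank_radTensor_hom_le (X Y : AlgModule.{u, v, v} k (C.Fiber 𝔪))
    [Module.Finite k X] [Module.Finite k Y] :
    Module.finrank k (radTensor X →ₗ[C.Fiber 𝔪] Y) ≤ Module.finrank k X * Module.finrank k Y := by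
  have : Module.Finite k (C.inflate X) := inferInstanceAs (Module.Finite k X)
  have : Module.Finite k (C.inflate Y) := inferInstanceAs (Module.Finite k Y)
  rw [finrank_radTensor_hom]
  exact finrank_quot_tensor_hom_le _ _ _

theorem finrank_radTensor_hom_eq_iff (X Y : AlgModule.{u, v, v} k (C.Fiber 𝔪))
    [Module.Finite k X] [Module.Finite k Y] :
    Module.finrank k (radTensor X →ₗ[C.Fiber 𝔪] Y) = Module.finrank k X * Module.finrank k Y ↔
      ∀ h ∈ C.radIdeal, ∀ φ : (C.inflate X).homMod (C.inflate Y), h • φ = 0 := by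
  have : Module.Finite k (C.inflate X) := inferInstanceAs (Module.Finite k X)
  have : Module.Finite k (C.inflate Y) := inferInstanceAs (Module.Finite k Y)
  rw [finrank_radTensor_hom]
  exact finrank_quot_tensor_hom_eq_iff C.radIdeal (C.inflate X) (C.inflate Y)

end RadTensor

variable {k : Type u} {H : Type v} [Field k] [IsAlgClosed k] [Ring H] [HopfAlgebra k H]
  [Algebra.FiniteType k H] (C : CentralHopfSubalgebra k H) [Module.Finite C.toSubalgebra H]

theorem finrank_quot_radIdeal : Module.finrank k (H ⧸ C.radIdeal) = C.Sd C.counitIdeal := by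
  have := C.finite_fiber C.counitIdeal_isMaximal
  rw [C.quotRadIdealEquiv.toLinearEquiv.finrank_eq, finrank_quotient_jacobson]
  rfl

theorem finite_quot_radIdeal : Module.Finite k (H ⧸ C.radIdeal) := by
  have := C.finite_fiber C.counitIdeal_isMaximal
  exact Module.Finite.equiv C.quotRadIdealEquiv.symm.toLinearEquiv

variable {C} {𝔪 : Ideal C.toSubalgebra}

theorem finrank_radTensor (X : AlgModule.{u, v, v} k (C.Fiber 𝔪)) :
    Module.finrank k (radTensor X) = C.Sd C.counitIdeal * Module.finrank k X := by
  rw [← C.finrank_quot_radIdeal]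
  exact finrank_tensor (V := quot C.radIdeal) (W := C.inflate X)

theorem finrank_radTensor_hom_pos (h𝔪 : 𝔪.IsMaximal) (X Y : AlgModule.{u, v, v} k (C.Fiber 𝔪))
    [Module.Finite k X] [Module.Finite k Y] [Nontrivial X] [Nontrivial Y] :
    0 < Module.finrank k (radTensor X →ₗ[C.Fiber 𝔪] Y) := by
  have := C.finite_fiber C.counitIdeal_isMaximal
  have : Module.Finite k (C.inflate X) := inferInstanceAs (Module.Finite k X)
  have : Module.Finite k (C.inflate Y) := inferInstanceAs (Module.Finite k Y)
  have : Nontrivial ((C.inflate X).homMod (C.inflate Y)) := by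
    refine Module.nontrivial_of_finrank_pos (R := k) ?_
    rw [finrank_homMod]
    exact Nat.mul_pos (Module.finrank_pos (R := k) (M := X)) (Module.finrank_pos (R := k) (M := Y))
  rw [finrank_radTensor_hom, finrank_quot_tensor_hom]
  exact C.finrank_invariants_radIdeal_pos _
    (C.fiberIdeal_smul_homMod h𝔪 (fiberIdeal_smul_inflate X) (fiberIdeal_smul_inflate Y))

/-- Every irreducible module `U` over the fiber algebra occurs in `H/J ⊗ W` with a multiplicity
proportional to `dim W dim U`. -/
theorem finrank_radTensor_hom_mul_Sd (hC : HasChevalleyProperty k (C.Fiber C.counitIdeal))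
    (h𝔪 : 𝔪.IsMaximal) (W U : Irr k (C.Fiber 𝔪)) :
    Module.finrank k (radTensor W.rep →ₗ[C.Fiber 𝔪] U.rep) * C.Sd 𝔪 =
      C.Sd C.counitIdeal * (Module.finrank k W.rep * Module.finrank k U.rep) := by
  have := C.finite_fiber h𝔪
  have := C.finite_fiber C.counitIdeal_isMaximal
  have := C.finite_quot_radIdeal
  have : Module.Finite k (quot (k := k) C.radIdeal) :=
    inferInstanceAs (Module.Finite k (H ⧸ C.radIdeal))
  have hfin : ∀ X : Irr k (C.Fiber 𝔪), Module.Finite k (C.inflate X.rep) :=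
    fun X => inferInstanceAs (Module.Finite k X.rep)
  have : ∀ X : Irr k (C.Fiber 𝔪), Module.Finite k (radTensor X.rep) := fun X =>
    inferInstanceAs (Module.Finite k ((quot C.radIdeal).tensor (C.inflate X.rep)))
  have hJ := C.isCoideal_radIdeal hC
  obtain ⟨t, ht, ht1⟩ := C.exists_integral_mod_radIdeal
  choose i p hp using fun X : Irr k (C.Fiber 𝔪) => exists_retract_quot_tensor C.radIdeal
    hJ.counit_eq_zero ht ht1 (C.inflate X.rep)
  refine finrank_hom_mul_sqDim (C.Sd C.counitIdeal) (fun X => radTensor X.rep)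
    (fun X => finrank_radTensor X.rep) (fun X Y => ?_)
    (fun X => (restrictHomDescend _ _ X.rep).symm (i X))
    (fun X => (descendHomRestrict _ _ X.rep).symm (p X)) hp (fun Y X a ha x => ?_) W U
  · have e := (descendHomDescend ((quot (k := k) C.radIdeal).tensor (C.inflate X.rep))
      (C.fiberIdeal_smul_tensor (𝔪 := 𝔪)
        (fun _ hh x => smul_quot _ (C.fiberIdeal_le_radIdeal hh) x) (fiberIdeal_smul_inflate X.rep))
      ((quot (k := k) C.radIdeal).tensor (C.inflate Y.rep)) (C.fiberIdeal_smul_tensor (𝔪 := 𝔪)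
        (fun _ hh x => smul_quot _ (C.fiberIdeal_le_radIdeal hh) x)
        (fiberIdeal_smul_inflate Y.rep))).finrank_eq
    have h := finrank_quot_mul_le C.radIdeal (C.inflate X.rep) (C.inflate Y.rep)
    rw [← e, C.finrank_quot_radIdeal, ← finrank_radTensor_hom] at h
    exact h
  · have := IsSimpleModule.nontrivial (C.Fiber 𝔪) X.rep
    have := IsSimpleModule.nontrivial (C.Fiber 𝔪) Y.rep
    have hpos := finrank_radTensor_hom_pos h𝔪 Y.rep X.rep
    have : Nontrivial (radTensor Y.rep →ₗ[C.Fiber 𝔪] X.rep) :=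
      Module.nontrivial_of_finrank_pos hpos
    obtain ⟨f, hf⟩ := exists_ne (0 : radTensor Y.rep →ₗ[C.Fiber 𝔪] X.rep)
    obtain ⟨a, rfl⟩ := Ideal.Quotient.mk_surjective a
    exact smul_quot_tensor_of_surjective C.radIdeal (U := C.inflate Y.rep) (W := C.inflate X.rep)
      (descendHomRestrict _ _ X.rep f)
      (show Function.Surjective f from LinearMap.surjective_of_ne_zero hf) ha x

end CentralHopfSubalgebra

/-! ### Square dimensions and the structure of `W ⊗ W*` -/

namespace CentralHopfSubalgebra

open AlgModule

section Irr

variable {k : Type u} {H : Type v} [Field k] [Ring H] [HopfAlgebra k H]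
  {C : CentralHopfSubalgebra k H} {𝔪 : Ideal C.toSubalgebra}

theorem nonempty_irr_fiber [Module.Finite C.toSubalgebra H] (h𝔪 : 𝔪.IsMaximal) :
    Nonempty (Irr k (C.Fiber 𝔪)) := by
  have := C.nontrivial_fiber h𝔪
  obtain ⟨M, hM⟩ := Ideal.exists_maximal (C.Fiber 𝔪)
  have : IsSimpleModule (C.Fiber 𝔪) (C.Fiber 𝔪 ⧸ M) := isSimpleModule_iff_isCoatom.2 hM.out
  exact ⟨(Irr.exists_linearEquiv_rep (k := k) (A := C.Fiber 𝔪) (S := C.Fiber 𝔪 ⧸ M)).choose⟩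

theorem Sd_eq_sum [Fintype (Irr k (C.Fiber 𝔪))] :
    C.Sd 𝔪 = ∑ X : Irr k (C.Fiber 𝔪), Module.finrank k X.rep ^ 2 :=
  finsum_eq_sum_of_fintype _

end Irr

variable {k : Type u} {H : Type v} [Field k] [IsAlgClosed k] [Ring H] [HopfAlgebra k H]
  [Algebra.FiniteType k H] {C : CentralHopfSubalgebra k H} [Module.Finite C.toSubalgebra H]
  {𝔪 : Ideal C.toSubalgebra}

theorem Sd_counitIdeal_le (hC : HasChevalleyProperty k (C.Fiber C.counitIdeal))
    (h𝔪 : 𝔪.IsMaximal) : C.Sd C.counitIdeal ≤ C.Sd 𝔪 := by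
  have := C.finite_fiber h𝔪
  obtain ⟨X⟩ := nonempty_irr_fiber h𝔪
  have h := finrank_radTensor_hom_mul_Sd hC h𝔪 X X
  have hle := Nat.mul_le_mul_right (C.Sd 𝔪) (finrank_radTensor_hom_le X.rep X.rep)
  rw [h, mul_comm] at hle
  exact Nat.le_of_mul_le_mul_left hle (Nat.mul_pos X.finrank_rep_pos X.finrank_rep_pos)

/-- Each irreducible module `U` occurs in `H/J ⊗ U`; summing the formula for the multiplicity over
all `U` yields the bound. -/
theorem card_irr_le (hC : HasChevalleyProperty k (C.Fiber C.counitIdeal)) (h𝔪 : 𝔪.IsMaximal) :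
    Nat.card (Irr k (C.Fiber 𝔪)) ≤ C.Sd C.counitIdeal := by
  have := C.finite_fiber h𝔪
  have := Fintype.ofFinite (Irr k (C.Fiber 𝔪))
  have hS := Sd_eq_sum (𝔪 := 𝔪)
  obtain ⟨X⟩ := nonempty_irr_fiber h𝔪
  have hpos : 0 < C.Sd 𝔪 := by
    rw [hS]
    exact Finset.sum_pos (fun Y _ => pow_pos Y.finrank_rep_pos 2) ⟨X, Finset.mem_univ X⟩
  refine Nat.le_of_mul_le_mul_right ?_ hpos
  calc Nat.card (Irr k (C.Fiber 𝔪)) * C.Sd 𝔪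
      = ∑ _U : Irr k (C.Fiber 𝔪), C.Sd 𝔪 := by simp
    _ ≤ ∑ U : Irr k (C.Fiber 𝔪), C.Sd C.counitIdeal * Module.finrank k U.rep ^ 2 := by
        refine Finset.sum_le_sum fun U _ => ?_
        have := IsSimpleModule.nontrivial (C.Fiber 𝔪) U.rep
        rw [sq, ← finrank_radTensor_hom_mul_Sd hC h𝔪 U U]
        exact Nat.le_mul_of_pos_left _ (finrank_radTensor_hom_pos h𝔪 U.rep U.rep)
    _ = C.Sd C.counitIdeal * C.Sd 𝔪 := by rw [← Finset.mul_sum, ← hS]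

/-- The square dimensions agree if and only if the radical of the identity fiber annihilates the
endomorphism spaces of all irreducible modules over the fiber. -/
theorem Sd_eq_iff (hC : HasChevalleyProperty k (C.Fiber C.counitIdeal)) (h𝔪 : 𝔪.IsMaximal) :
    C.Sd 𝔪 = C.Sd C.counitIdeal ↔ ∀ X : Irr k (C.Fiber 𝔪), ∀ h ∈ C.radIdeal,
      ∀ φ : (C.inflate X.rep).homMod (C.inflate X.rep), h • φ = 0 := by
  have := C.finite_fiber h𝔪
  have := Fintype.ofFinite (Irr k (C.Fiber 𝔪))
  simp_rw [← finrank_radTensor_hom_eq_iff]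
  obtain ⟨Y⟩ := nonempty_irr_fiber h𝔪
  have hpos : 0 < C.Sd 𝔪 := by
    rw [Sd_eq_sum (𝔪 := 𝔪)]
    exact Finset.sum_pos (fun Y _ => pow_pos Y.finrank_rep_pos 2) ⟨Y, Finset.mem_univ Y⟩
  constructor
  · intro h X
    have hX := finrank_radTensor_hom_mul_Sd hC h𝔪 X X
    rw [← h, mul_comm] at hX
    exact Nat.eq_of_mul_eq_mul_left hpos hX
  · intro h
    have hY := finrank_radTensor_hom_mul_Sd hC h𝔪 Y Y
    rw [h Y, mul_comm] at hY
    exact Nat.eq_of_mul_eq_mul_right (Nat.mul_pos Y.finrank_rep_pos Y.finrank_rep_pos) hY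

theorem isSemisimpleModule_tensorDual_iff (h𝔪 : 𝔪.IsMaximal)
    (W : AlgModule.{u, v, v} k (C.Fiber 𝔪)) [Module.Finite k W] :
    IsSemisimpleModule (C.Fiber C.counitIdeal) (C.tensorDual h𝔪 W) ↔
      ∀ h ∈ C.radIdeal, ∀ φ : (C.inflate W).homMod (C.inflate W), h • φ = 0 := by
  have := C.finite_fiber C.counitIdeal_isMaximal
  have : Module.Finite k (C.inflate W) := inferInstanceAs (Module.Finite k W)
  have hb := tensorDualHom_bijective (C.inflate W) (C.inflate W)
  refine (C.isSemisimpleModule_descend_iff _ _).trans ⟨fun H0 h hh φ => ?_, fun H0 h hh x => ?_⟩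
  · obtain ⟨x, rfl⟩ := hb.2 φ
    rw [← map_smul, H0 h hh, map_zero]
  · apply hb.1
    rw [map_smul, H0 h hh, map_zero]

/-- `Hom_H(V, W ⊗ W*) ≃ Hom_H(V ⊗ W, W)` as an equality of dimensions. -/
theorem finrank_hom_tensorDual (h𝔪 : 𝔪.IsMaximal)
    (W : AlgModule.{u, v, v} k (C.Fiber 𝔪)) [Module.Finite k W]
    (V : AlgModule.{u, v, v} k (C.Fiber C.counitIdeal)) :
    Module.finrank k (V →ₗ[C.Fiber C.counitIdeal] C.tensorDual h𝔪 W) =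
      Module.finrank k ((C.inflate V).tensor (C.inflate W) →ₗ[H] C.inflate W) := by
  have : Module.Finite k (C.inflate W) := inferInstanceAs (Module.Finite k W)
  have e := LinearEquiv.ofBijective _ (tensorDualHom_bijective (C.inflate W) (C.inflate W))
  rw [(curryEquiv _ _ _).finrank_eq, ← finrank_hom_congr_right (k := k) e]
  exact (restrictHomDescend _ _ V).finrank_eq

theorem nonempty_linearEquiv_of_isSemisimpleModule (h𝔪 : 𝔪.IsMaximal)
    (W : AlgModule.{u, v, v} k (C.Fiber 𝔪)) [Module.Finite k W]
    (hW : IsSemisimpleModule (C.Fiber C.counitIdeal) (C.tensorDual h𝔪 W)) :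
    Nonempty ((C.inflate W).tensor (C.inflate W).dual ≃ₗ[H]
      DirectSum (Irr k (C.Fiber C.counitIdeal)) fun V =>
        Fin (Module.finrank k ((C.inflate V.rep).tensor (C.inflate W) →ₗ[H] C.inflate W)) →
          C.inflate V.rep) := by
  classical
  have := C.finite_fiber C.counitIdeal_isMaximal
  have := Fintype.ofFinite (Irr k (C.Fiber C.counitIdeal))
  have : Module.Finite k (C.tensorDual h𝔪 W) :=
    inferInstanceAs (Module.Finite k (W ⊗[k] Module.Dual k W))
  have : Module.Finite (C.Fiber C.counitIdeal) (C.tensorDual h𝔪 W) :=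
    .of_restrictScalars_finite k _ _
  obtain ⟨e⟩ := IsSemisimpleModule.nonempty_linearEquiv_isotypic (k := k)
    (A := C.Fiber C.counitIdeal) (C.tensorDual h𝔪 W)
  let e' : (C.inflate W).tensor (C.inflate W).dual ≃ₗ[H] ∀ V : Irr k (C.Fiber C.counitIdeal),
      Fin (Module.finrank k (V.rep →ₗ[C.Fiber C.counitIdeal] C.tensorDual h𝔪 W)) →
        C.inflate V.rep :=
    { toFun := e
      invFun := e.symm
      left_inv := e.left_inv
      right_inv := e.right_inv
      map_add' := e.map_add
      map_smul' := fun h x => e.map_smul (Ideal.Quotient.mk (C.fiberIdeal C.counitIdeal) h) x }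
  exact ⟨(e'.trans (LinearEquiv.piCongrRight fun V => LinearEquiv.funCongrLeft H (C.inflate V.rep)
    (finCongr (finrank_hom_tensorDual h𝔪 W V.rep).symm))).trans
    (DirectSum.linearEquivFunOnFintype H _ _).symm⟩

theorem isSemisimpleModule_of_linearEquiv (h𝔪 : 𝔪.IsMaximal)
    (W : AlgModule.{u, v, v} k (C.Fiber 𝔪)) (n : Irr k (C.Fiber C.counitIdeal) → ℕ)
    (e : (C.inflate W).tensor (C.inflate W).dual ≃ₗ[H]
      DirectSum (Irr k (C.Fiber C.counitIdeal)) fun V => Fin (n V) → C.inflate V.rep) :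
    IsSemisimpleModule (C.Fiber C.counitIdeal) (C.tensorDual h𝔪 W) := by
  have := C.finite_fiber C.counitIdeal_isMaximal
  refine (C.isSemisimpleModule_descend_iff _ _).2 fun h hh x => e.injective ?_
  rw [map_smul, map_zero]
  ext V : 1
  funext j
  exact jacobson_smul_of_isSemisimpleModule ((C.mem_radIdeal h).1 hh) (M := V.rep) (e x V j)

end CentralHopfSubalgebra

theorem mainTheorem5 {k : Type u} {H : Type v} [Field k] [IsAlgClosed k] [CharZero k]
    [Ring H] [HopfAlgebra k H] [Algebra.FiniteType k H]
    (C : CentralHopfSubalgebra k H) [Module.Finite C.toSubalgebra H]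
    (hC : HasChevalleyProperty k (C.Fiber C.counitIdeal))
    (𝔪 : Ideal C.toSubalgebra) (h𝔪 : 𝔪.IsMaximal) :
    (Finite (Irr k (C.Fiber 𝔪)) ∧ Finite (Irr k (C.Fiber C.counitIdeal))) ∧
    (C.Sd C.counitIdeal ≤ C.Sd 𝔪 ∧ Nat.card (Irr k (C.Fiber 𝔪)) ≤ C.Sd C.counitIdeal) ∧
    List.TFAE [
      C.Sd 𝔪 = C.Sd C.counitIdeal,
      ∀ W : AlgModule.{u, v, v} k (C.Fiber 𝔪), IsSimpleModule (C.Fiber 𝔪) W →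
        Nonempty ((C.inflate W).tensor (C.inflate W).dual ≃ₗ[H]
          DirectSum (Irr k (C.Fiber C.counitIdeal)) fun V =>
            Fin (Module.finrank k ((C.inflate V.rep).tensor (C.inflate W) →ₗ[H] C.inflate W)) →
              C.inflate V.rep),
      ∀ W : AlgModule.{u, v, v} k (C.Fiber 𝔪), IsSimpleModule (C.Fiber 𝔪) W →
        IsSemisimpleModule (C.Fiber C.counitIdeal) (C.tensorDual h𝔪 W)] := by
  have := C.finite_fiber h𝔪
  have := C.finite_fiber C.counitIdeal_isMaximal
  have hfin : ∀ W : AlgModule.{u, v, v} k (C.Fiber 𝔪), IsSimpleModule (C.Fiber 𝔪) W →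
      Module.Finite k W := fun W _ => Module.Finite.trans (C.Fiber 𝔪) W
  refine ⟨⟨inferInstance, inferInstance⟩,
    ⟨CentralHopfSubalgebra.Sd_counitIdeal_le hC h𝔪, CentralHopfSubalgebra.card_irr_le hC h𝔪⟩, ?_⟩
  tfae_have 1 → 3 := by
    intro h W hW
    have := hfin W hW
    rw [CentralHopfSubalgebra.isSemisimpleModule_tensorDual_iff]
    intro a ha φ
    obtain ⟨X, ⟨e⟩⟩ := Irr.exists_linearEquiv_rep (k := k) (A := C.Fiber 𝔪) (S := W)
    let e' : C.inflate W ≃ₗ[H] C.inflate X.rep :=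
      { toFun := e
        invFun := e.symm
        left_inv := e.left_inv
        right_inv := e.right_inv
        map_add' := e.map_add
        map_smul' := fun h x => e.map_smul (Ideal.Quotient.mk (C.fiberIdeal 𝔪) h) x }
    exact AlgModule.homMod_smul_eq_zero_of_equiv e'
      ((CentralHopfSubalgebra.Sd_eq_iff hC h𝔪).1 h X a ha) φ
  tfae_have 3 → 1 := fun h => (CentralHopfSubalgebra.Sd_eq_iff hC h𝔪).2 fun X =>
    (CentralHopfSubalgebra.isSemisimpleModule_tensorDual_iff h𝔪 X.rep).1 (h X.rep inferInstance)
  tfae_have 3 → 2 := by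
    intro h W hW
    have := hfin W hW
    exact CentralHopfSubalgebra.nonempty_linearEquiv_of_isSemisimpleModule h𝔪 W (h W hW)
  tfae_have 2 → 3 := by
    intro h W hW
    obtain ⟨e⟩ := h W hW
    exact CentralHopfSubalgebra.isSemisimpleModule_of_linearEquiv h𝔪 W _ e
  tfae_finish
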